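/- Let $\mathbb H=\mathbb R+\mathbf i\mathbb R+\mathbf j\mathbb R+\mathbf k\mathbb R$ and regard $\mathbb H^n$ as a right $\mathbb H$-vector space with the skew-Hermitian form $\langle x,y\rangle=\bar x^{\,t}\,\mathbf j\,y$. Let $$\mathrm{SO}^*(2n)=\{g\in \mathrm{GL}_n(\mathbb H): \mathrm{Nrd}(g)=1,\ \bar g^{\,t}\,\mathbf jI_n\, g=\mathbf jI_n\},\qquad \mathfrak{so}^*(2n)=\{z\in \mathrm M_n(\mathbb H): \mathrm{Trd}(z)=0,\ \bar z^{\,t}\,\mathbf jI_n+\mathbf jI_n\,z=0\},$$ where $\mathrm{Nrd}$ and $\mathrm{Trd}$ are the reduced norm and the reduced trace of $\mathrm M_n(\mathbb H)$. An element $X\in\mathfrak{so}^*(2n)$ is called real if $gXg^{-1}=-X$ for some $g\in \mathrm{SO}^*(2n)$, and strongly real if $\tau X\tau^{-1}=-X$ for some $\tau\in \mathrm{SO}^*(2n)$ with $\tau^2=1$. Let $X\in\mathfrak{so}^*(2n)$ be nilpotent (as a matrix). If $X\ne0$, let $\{X,H,Y\}\subset\mathfrak{so}^*(2n)$ be an $\mathfrak{sl}_2$-triple,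 i.e. $[H,X]=2X$, $[H,Y]=-2Y$, $[X,Y]=H$; if $X=0$, put $H=Y=0$. For $d\ge1$ let $L(d-1)=\{v\in\mathbb H^n: Yv=0,\ Hv=(1-d)v\}$ be the space of lowest weight vectors of the $d$-dimensional irreducible $\mathrm{Span}_{\mathbb R}\{X,H,Y\}$-submodules of $\mathbb H^n$, and let $t_d=\dim_{\mathbb H}L(d-1)$. There are $\mathbb H$-bases $v^d_1,\dots,v^d_{t_d}$ of the spaces $L(d-1)$ such that $X^dv^d_j=0$, the vectors $X^lv^d_j$ $(d\ge1,\ 1\le j\le t_d,\ 0\le l<d)$ form an $\mathbb H$-basis of $\mathbb H^n$, $\langle X^lv^d_j,X^{l'}v^{d'}_{j'}\rangle=0$ unless $d=d'$, $j=j'$ and $l+l'=d-1$, and $\langle v^d_j,X^{d-1}v^d_j\rangle$ equals $\pm1$ for $d$ even and $\mathbf j$ for $d$ odd. The signed Young diagram of $X$ has $t_d$ rows of length $d$ for each $d\geq 1$. For even $d$, the leftmost boxes of $p_d$ of these rows are labelled $+1$ and those of the other $q_d$ rows are labelled $-1$, where $p_d=\#\{j:\langle v^d_j,X^{d-1}v^d_j\rangle=1\}$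 and $q_d=t_d-p_d$; for odd $d$ all leftmost boxes are labelled $+1$. Theorem. For every nilpotent $X\in\mathfrak{so}^*(2n)$ such a triple and such bases (hence a signed Young diagram of $X$) exist, and for any choice of them the following are equivalent: 1. $X$ is real; 2. $X$ is strongly real; 3. $p_\eta=q_\eta$ for every even part $\eta$ of the partition $[d^{t_d}]_{d\ge1}$ of $n$. -/

import Mathlib

open scoped Quaternion Matrix

attribute [local instance] LieRing.ofAssociativeRing

namespace SOStar

/-- The quaternion unit `j`. -/
noncomputable def jUnit : ℍ[ℝ] := ⟨0, 0, 1, 0⟩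

/-- The matrix `j I_n`. -/
noncomputable def jMat (n : ℕ) : Matrix (Fin n) (Fin n) ℍ[ℝ] := Matrix.diagonal fun _ => jUnit

/-- The standard skew-Hermitian form `⟨x, y⟩ = x̄ᵗ j I_n y` on the right `ℍ`-vector space `ℍⁿ`.
Right scalar multiplication is encoded as the action of the opposite ring. -/
noncomputable def form {n : ℕ} (x y : Fin n → ℍ[ℝ]) : ℍ[ℝ] := star x ⬝ᵥ (jMat n *ᵥ y)

/-- Writing `q = z + w j` with `z, w` complex, this is `z`. -/
def zPart (q : ℍ[ℝ]) : ℂ := ⟨q.re, q.imI⟩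

/-- Writing `q = z + w j` with `z, w` complex, this is `w`. -/
def wPart (q : ℍ[ℝ]) : ℂ := ⟨q.imJ, q.imK⟩

/-- The standard embedding `M_n(ℍ) → M_{2n}(ℂ)`: for `A = Z + W j`, the matrix with block rows
`(Z, W)` and `(-W̄, Z̄)`. It splits the central simple `ℝ`-algebra `M_n(ℍ)`. -/
noncomputable def toComplex {n : ℕ} (A : Matrix (Fin n) (Fin n) ℍ[ℝ]) :
    Matrix (Fin n ⊕ Fin n) (Fin n ⊕ Fin n) ℂ :=
  Matrix.fromBlocks (A.map zPart) (A.map wPart)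
    (A.map fun q => -star (wPart q)) (A.map fun q => star (zPart q))

theorem zPart_sum {n : ℕ} (f : Fin n → ℍ[ℝ]) : zPart (∑ i, f i) = ∑ i, zPart (f i) :=
  map_sum (⟨⟨zPart, by simp [zPart, Complex.ext_iff]⟩,
    by intro a b; simp [zPart, Complex.ext_iff]⟩ : ℍ[ℝ] →+ ℂ) f _

theorem wPart_sum {n : ℕ} (f : Fin n → ℍ[ℝ]) : wPart (∑ i, f i) = ∑ i, wPart (f i) :=
  map_sum (⟨⟨wPart, by simp [wPart, Complex.ext_iff]⟩,
    by intro a b; simp [wPart, Complex.ext_iff]⟩ : ℍ[ℝ] →+ ℂ) f _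

theorem zPart_mul (a b : ℍ[ℝ]) :
    zPart (a * b) = zPart a * zPart b + wPart a * -star (wPart b) := by
  apply Complex.ext <;> simp [zPart, wPart] <;> ring

theorem wPart_mul (a b : ℍ[ℝ]) :
    wPart (a * b) = zPart a * wPart b + wPart a * star (zPart b) := by
  apply Complex.ext <;> simp [zPart, wPart] <;> ring

theorem toComplex_mul {n : ℕ} (A B : Matrix (Fin n) (Fin n) ℍ[ℝ]) :
    toComplex (A * B) = toComplex A * toComplex B := by
  rw [toComplex, toComplex, toComplex, Matrix.fromBlocks_multiply]
  congr 1 <;> ext i k <;>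
    simp only [Matrix.add_apply, Matrix.mul_apply, Matrix.map_apply, zPart_sum, wPart_sum,
      star_sum, ← Finset.sum_neg_distrib, ← Finset.sum_add_distrib] <;>
    apply Finset.sum_congr rfl <;> intro x _ <;>
    simp only [zPart_mul, wPart_mul, star_add, star_mul', star_neg, star_star] <;> ring

theorem toComplex_one (n : ℕ) : toComplex (1 : Matrix (Fin n) (Fin n) ℍ[ℝ]) = 1 := by
  rw [← Matrix.fromBlocks_one, toComplex]
  congr 1 <;> ext i k <;> by_cases h : i = k <;>
    simp [h, zPart, wPart, Matrix.one_apply, Complex.ext_iff]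

theorem toComplex_add {n : ℕ} (A B : Matrix (Fin n) (Fin n) ℍ[ℝ]) :
    toComplex (A + B) = toComplex A + toComplex B := by
  rw [toComplex, toComplex, toComplex, Matrix.fromBlocks_add]
  congr 1 <;> ext i k <;> simp [zPart, wPart, Complex.ext_iff] <;> ring

theorem toComplex_smul {n : ℕ} (c : ℝ) (A : Matrix (Fin n) (Fin n) ℍ[ℝ]) :
    toComplex (c • A) = c • toComplex A := by
  rw [toComplex, toComplex, Matrix.fromBlocks_smul]
  congr 1 <;> ext i k <;> simp [zPart, wPart, Complex.ext_iff]

theorem toComplex_zero (n : ℕ) : toComplex (0 : Matrix (Fin n) (Fin n) ℍ[ℝ]) = 0 := by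
  simpa using toComplex_smul 0 (0 : Matrix (Fin n) (Fin n) ℍ[ℝ])

/-- The reduced norm of the central simple algebra `M_n(ℍ)`. -/
noncomputable def nrd {n : ℕ} (A : Matrix (Fin n) (Fin n) ℍ[ℝ]) : ℂ := (toComplex A).det

/-- The reduced trace of the central simple algebra `M_n(ℍ)`. -/
noncomputable def trd {n : ℕ} (A : Matrix (Fin n) (Fin n) ℍ[ℝ]) : ℂ := (toComplex A).trace

/-- The Lie group `SO*(2n)`, as the subgroup of `GL_n(ℍ)` of all `g` with `Nrd g = 1` and
`ḡᵗ (j I_n) g = j I_n`. -/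
noncomputable def group (n : ℕ) : Subgroup (Matrix (Fin n) (Fin n) ℍ[ℝ])ˣ where
  carrier := {g | nrd g.val = 1 ∧ g.valᴴ * jMat n * g.val = jMat n}
  one_mem' := by simp [nrd, toComplex_one]
  mul_mem' := by
    rintro a b ⟨ha, ha'⟩ ⟨hb, hb'⟩
    refine ⟨?_, ?_⟩
    · simp only [nrd] at ha hb ⊢
      rw [Units.val_mul, toComplex_mul, Matrix.det_mul, ha, hb, one_mul]
    · rw [Units.val_mul, Matrix.conjTranspose_mul]
      calc _ = b.valᴴ * (a.valᴴ * jMat n * a.val) * b.val := by simp only [mul_assoc]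
        _ = jMat n := by rw [ha', hb']
  inv_mem' := by
    rintro a ⟨ha, ha'⟩
    have h1 : a.val * (a⁻¹).val = 1 := a.mul_inv
    have h2 : (a⁻¹).valᴴ * a.valᴴ = 1 := by
      rw [← Matrix.conjTranspose_mul, h1, Matrix.conjTranspose_one]
    refine ⟨?_, ?_⟩
    · have h := congrArg (fun M => (toComplex M).det) h1
      simp only [nrd, toComplex_mul, Matrix.det_mul, toComplex_one, Matrix.det_one] at h ha ⊢
      rwa [ha, one_mul] at h
    · calc _ = (a⁻¹).valᴴ * (a.valᴴ * jMat n * a.val) * (a⁻¹).val := by rw [ha']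
        _ = ((a⁻¹).valᴴ * a.valᴴ) * jMat n * (a.val * (a⁻¹).val) := by simp only [mul_assoc]
        _ = jMat n := by rw [h1, h2, one_mul, mul_one]

/-- The real Lie algebra `so*(2n)` of all `z ∈ M_n(ℍ)` with `Trd z = 0` and
`z̄ᵗ (j I_n) + (j I_n) z = 0`. -/
noncomputable def lieAlg (n : ℕ) : LieSubalgebra ℝ (Matrix (Fin n) (Fin n) ℍ[ℝ]) where
  carrier := {z | trd z = 0 ∧ zᴴ * jMat n + jMat n * z = 0}
  zero_mem' := by simp [trd, toComplex_zero]
  add_mem' := by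
    rintro a b ⟨ha, ha'⟩ ⟨hb, hb'⟩
    refine ⟨?_, ?_⟩
    · simp only [trd] at ha hb ⊢
      rw [toComplex_add, Matrix.trace_add, ha, hb, add_zero]
    · rw [Matrix.conjTranspose_add, add_mul, mul_add, add_add_add_comm, ha', hb', add_zero]
  smul_mem' := by
    rintro c a ⟨ha, ha'⟩
    refine ⟨?_, ?_⟩
    · simp only [trd] at ha ⊢
      rw [toComplex_smul, Matrix.trace_smul, ha, smul_zero]
    · have hc : (c • a)ᴴ = c • aᴴ := by
        ext i k <;> simp [Matrix.conjTranspose_apply]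
      rw [hc, smul_mul_assoc, mul_smul_comm, ← smul_add, ha',
        smul_zero]
  lie_mem' := by
    rintro a b ⟨ha, ha'⟩ ⟨hb, hb'⟩
    have ea : aᴴ * jMat n = -(jMat n * a) := eq_neg_of_add_eq_zero_left ha'
    have eb : bᴴ * jMat n = -(jMat n * b) := eq_neg_of_add_eq_zero_left hb'
    refine ⟨?_, ?_⟩
    · have hsub : toComplex ⁅a, b⁆ + toComplex (b * a) = toComplex (a * b) := by
        rw [← toComplex_add, Ring.lie_def, sub_add_cancel]
      have h := congrArg Matrix.trace hsub
      rw [Matrix.trace_add, toComplex_mul, toComplex_mul,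
        Matrix.trace_mul_comm (toComplex b)] at h
      simpa [trd] using h
    · rw [Ring.lie_def, Matrix.conjTranspose_sub, Matrix.conjTranspose_mul,
        Matrix.conjTranspose_mul, sub_mul, mul_assoc, mul_assoc, ea, eb, mul_neg, mul_neg,
        ← mul_assoc, ← mul_assoc, ea, eb]
      noncomm_ring

/-- `X` is `Ad`-real: `-X` lies in the `SO*(2n)`-adjoint orbit of `X`. -/
def IsAdReal {n : ℕ} (X : Matrix (Fin n) (Fin n) ℍ[ℝ]) : Prop :=
  ∃ g ∈ group n, g.val * X * (g⁻¹).val = -X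

/-- `X` is strongly `Ad`-real: `-X = Ad(τ) X` for some `τ ∈ SO*(2n)` with `τ² = 1`. -/
def IsStronglyAdReal {n : ℕ} (X : Matrix (Fin n) (Fin n) ℍ[ℝ]) : Prop :=
  ∃ τ ∈ group n, τ ^ 2 = 1 ∧ τ.val * X * (τ⁻¹).val = -X

/-- `(X, H, Y)` is an `sl₂`-triple in `so*(2n)`; for `X = 0` the zero triple is used. -/
def IsTriple {n : ℕ} (X H Y : Matrix (Fin n) (Fin n) ℍ[ℝ]) : Prop :=
  X ∈ lieAlg n ∧ H ∈ lieAlg n ∧ Y ∈ lieAlg n ∧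
    (IsSl2Triple H X Y ∨ (X = 0 ∧ H = 0 ∧ Y = 0))

/-- The space `L(d-1)` of lowest weight vectors (killed by `Y`) of the `d`-dimensional irreducible
`Span_ℝ{X, H, Y}`-submodules of `ℍⁿ`, that is, of those of weight `1 - d`; it is a right
`ℍ`-subspace. -/
noncomputable def lowestWeight {n : ℕ} (H Y : Matrix (Fin n) (Fin n) ℍ[ℝ]) (d : ℕ) :
    Submodule ℍ[ℝ]ᵐᵒᵖ (Fin n → ℍ[ℝ]) where
  carrier := {v | Y *ᵥ v = 0 ∧ H *ᵥ v = (1 - (d : ℝ)) • v}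
  zero_mem' := by simp
  add_mem' := by
    rintro a b ⟨ha, ha'⟩ ⟨hb, hb'⟩
    exact ⟨by rw [Matrix.mulVec_add, ha, hb, add_zero], by
      rw [Matrix.mulVec_add, ha', hb', smul_add]⟩
  smul_mem' := by
    rintro c a ⟨ha, ha'⟩
    exact ⟨by rw [Matrix.mulVec_smul, ha, smul_zero], by
      rw [Matrix.mulVec_smul, ha', smul_comm]⟩

/-- A signed Young diagram of size `n` up to equivalence: a partition of `n` (the row lengths),
and for each `d` the numbers `p d` and `q d` of rows of length `d` whose leftmost box is labelled
`+1`, respectively `-1`. The labels of the first column determine all other labels. -/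
structure SignedYoungDiagram (n : ℕ) where
  partition : n.Partition
  p : ℕ → ℕ
  q : ℕ → ℕ
  p_add_q : ∀ d, p d + q d = partition.parts.count d

/-- `v d j`, where `j < t d`, are normalized lowest weight vectors for the triple `(X, H, Y)`: for
each `d ≥ 1` they form an `ℍ`-basis of `L(d-1)`, all `X^l v d j` with `l < d` together form an
`ℍ`-basis of `ℍⁿ`, and `⟨·,·⟩` takes the standard values on this basis. -/
structure IsAdaptedBasis {n : ℕ} (X H Y : Matrix (Fin n) (Fin n) ℍ[ℝ]) (t : ℕ → ℕ)
    (v : (d : ℕ) → Fin (t d) → Fin n → ℍ[ℝ]) : Prop where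
  linearIndependent_lowest : ∀ d, 1 ≤ d → LinearIndependent ℍ[ℝ]ᵐᵒᵖ (v d)
  span_lowest : ∀ d, 1 ≤ d →
    Submodule.span ℍ[ℝ]ᵐᵒᵖ (Set.range (v d)) = lowestWeight H Y d
  pow_eq_zero : ∀ d (j : Fin (t d)), X ^ d *ᵥ v d j = 0
  linearIndependent : LinearIndependent ℍ[ℝ]ᵐᵒᵖ
    (fun b : (d : ℕ) × (Fin (t d) × Fin d) => X ^ (b.2.2 : ℕ) *ᵥ v b.1 b.2.1)
  span_eq_top : Submodule.span ℍ[ℝ]ᵐᵒᵖ (Set.range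
    (fun b : (d : ℕ) × (Fin (t d) × Fin d) => X ^ (b.2.2 : ℕ) *ᵥ v b.1 b.2.1)) = ⊤
  form_eq_zero : ∀ d d' (j : Fin (t d)) (j' : Fin (t d')) (l l' : ℕ), l < d → l' < d' →
    ¬ (d = d' ∧ (j : ℕ) = (j' : ℕ) ∧ l + l' + 1 = d) →
      form (X ^ l *ᵥ v d j) (X ^ l' *ᵥ v d' j') = 0
  form_even : ∀ d (j : Fin (t d)), Even d →
    form (v d j) (X ^ (d - 1) *ᵥ v d j) = 1 ∨ form (v d j) (X ^ (d - 1) *ᵥ v d j) = -1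
  form_odd : ∀ d (j : Fin (t d)), Odd d → form (v d j) (X ^ (d - 1) *ᵥ v d j) = jUnit

/-- `D` is the signed Young diagram of the nilpotent element `X` of `so*(2n)`: for some
`sl₂`-triple containing `X` and some adapted basis, the partition of `D` has `t d = dim_ℍ L(d-1)`
parts equal to `d`; for `d` even, `p d` counts the `j` with `⟨v d j, X^(d-1) v d j⟩ = 1` (so `q d`
counts those with value `-1`); rows of odd length have leftmost label `+1`. -/
def HasSignedYoungDiagram {n : ℕ} (X : Matrix (Fin n) (Fin n) ℍ[ℝ])
    (D : SignedYoungDiagram n) : Prop :=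
  ∃ (H Y : Matrix (Fin n) (Fin n) ℍ[ℝ])
    (v : (d : ℕ) → Fin (D.partition.parts.count d) → Fin n → ℍ[ℝ]),
    IsTriple X H Y ∧ IsAdaptedBasis X H Y (fun d => D.partition.parts.count d) v ∧
    (∀ d, Even d → D.p d =
      {j : Fin (D.partition.parts.count d) |
        form (v d j) (X ^ (d - 1) *ᵥ v d j) = 1}.ncard) ∧
    (∀ d, Odd d → D.p d = D.partition.parts.count d)

end SOStar

namespace SOStar

variable {n : ℕ}

/-! ### The quaternion unit `j` -/

/-! Existence. Since `X` is skew-adjoint, `⟨x, X ^ m y⟩` is skew-Hermitian for even `m` and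
Hermitian for odd `m` (`star_form_pow`). On a nondegenerate `X`-stable subspace take `m` maximal
with `X ^ m ≠ 0`. Polarization gives a vector `v` with `⟨v, X ^ m v⟩ ≠ 0`. Rescaling `v` makes this
value `±1` (a Hermitian quaternion is real) or `j` (a pure quaternion is a positive multiple of a
conjugate of `j`), and adding multiples of higher `X ^ k v` clears the other pairings inside the
chain (`exists_normalized_chain`). The chain then spans a nondegenerate subspace, and induction on
its orthogonal complement decomposes `ℍⁿ` (`exists_frame`). The standard weight formulas on such a
basis define `H` and `Y`, which are again skew-adjoint (`IsChainBasis.isTriple`,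
`IsChainBasis.isAdaptedBasis`).

Real implies balanced. Let `g` be an isometry with `g X = -X g`, and let `d` be even. Then `g`
preserves `ker X ^ d` and negates the Hermitian form `⟨y, X ^ (d - 1) y⟩` there. Modulo its radical
this form has signature `(p_d, q_d)`, so the argument of Sylvester's law of inertia forces `p_d =
q_d` (`IsChainBasis.form_pow_nonneg`, `IsChainBasis.card_le_card_neg`).

Balanced implies strongly real. Choose an involution `s` of the rows of each length that exchanges
the two signs when the length is even and is trivial when it is odd. Then `X ^ l v_j ↦ (-1) ^ l X ^
l v_{s j}` is an isometric involution anticommuting with `X` (`IsChainBasis.isStronglyAdReal`). It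
is real in a suitable basis, so its reduced norm is the square of a real determinant, hence `1`
(`nrd_eq_one_of_real`). -/

@[simp] theorem re_jUnit : jUnit.re = 0 := rfl

@[simp] theorem imI_jUnit : jUnit.imI = 0 := rfl

@[simp] theorem imJ_jUnit : jUnit.imJ = 1 := rfl

@[simp] theorem imK_jUnit : jUnit.imK = 0 := rfl

theorem star_jUnit : star jUnit = -jUnit := by ext <;> simp

theorem jUnit_mul_jUnit : jUnit * jUnit = -1 := by ext <;> simp

theorem jUnit_ne_zero : jUnit ≠ 0 := fun h => by simpa [h] using jUnit_mul_jUnit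

/-! ### The skew-Hermitian form -/

theorem form_add_right (x y z : Fin n → ℍ[ℝ]) : form x (y + z) = form x y + form x z := by
  simp [form, Matrix.mulVec_add, dotProduct_add]

theorem form_add_left (x y z : Fin n → ℍ[ℝ]) : form (x + y) z = form x z + form y z := by
  simp [form, add_dotProduct]

theorem form_smul_right (c : ℍ[ℝ]ᵐᵒᵖ) (x y : Fin n → ℍ[ℝ]) :
    form x (c • y) = form x y * c.unop := by
  rw [form, Matrix.mulVec_smul, dotProduct_smul, form, MulOpposite.smul_eq_mul_unop]

theorem star_form (x y : Fin n → ℍ[ℝ]) : star (form x y) = -form y x := by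
  simp only [form, dotProduct, jMat, Matrix.mulVec_diagonal, star_sum, ← Finset.sum_neg_distrib]
  refine Finset.sum_congr rfl fun i _ => ?_
  simp [star_jUnit, mul_assoc]

theorem form_smul_left (c : ℍ[ℝ]ᵐᵒᵖ) (x y : Fin n → ℍ[ℝ]) :
    form (c • x) y = star c.unop * form x y := by
  rw [← neg_neg (form (c • x) y), ← star_form, form_smul_right, star_mul, star_form, mul_neg,
    neg_neg]

/-- `form x` as a linear map. -/
noncomputable def formRight (x : Fin n → ℍ[ℝ]) : (Fin n → ℍ[ℝ]) →ₗ[ℍ[ℝ]ᵐᵒᵖ] ℍ[ℝ] where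
  toFun := form x
  map_add' := form_add_right x
  map_smul' c y := form_smul_right c x y

/-- `form · y` as an additive map. -/
noncomputable def formLeft (y : Fin n → ℍ[ℝ]) : (Fin n → ℍ[ℝ]) →+ ℍ[ℝ] :=
  AddMonoidHom.mk' (fun x => form x y) fun a b => form_add_left a b y

@[simp] theorem form_zero_right (x : Fin n → ℍ[ℝ]) : form x 0 = 0 := (formRight x).map_zero

@[simp] theorem form_zero_left (x : Fin n → ℍ[ℝ]) : form 0 x = 0 := (formLeft x).map_zero

theorem form_sum_right {ι : Type*} (s : Finset ι) (x : Fin n → ℍ[ℝ]) (f : ι → Fin n → ℍ[ℝ]) :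
    form x (∑ i ∈ s, f i) = ∑ i ∈ s, form x (f i) := map_sum (formRight x) f s

theorem form_sum_left {ι : Type*} (s : Finset ι) (x : Fin n → ℍ[ℝ]) (f : ι → Fin n → ℍ[ℝ]) :
    form (∑ i ∈ s, f i) x = ∑ i ∈ s, form (f i) x := map_sum (formLeft x) f s

theorem form_sub_right (x y z : Fin n → ℍ[ℝ]) : form x (y - z) = form x y - form x z :=
  (formRight x).map_sub y z

theorem form_eq_zero_symm {x y : Fin n → ℍ[ℝ]} (h : form x y = 0) : form y x = 0 := by
  simpa [h] using star_form x y

theorem real_smul_eq_op_smul (r : ℝ) (x : Fin n → ℍ[ℝ]) :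
    r • x = MulOpposite.op (r : ℍ[ℝ]) • x := by
  funext i
  simp [MulOpposite.smul_eq_mul_unop, (Quaternion.coe_commutes r (x i)).symm,
    Quaternion.coe_mul_eq_smul]

theorem form_real_smul_right (r : ℝ) (x y : Fin n → ℍ[ℝ]) : form x (r • y) = r • form x y := by
  rw [real_smul_eq_op_smul, form_smul_right, MulOpposite.unop_op, Quaternion.mul_coe_eq_smul]

theorem form_real_smul_left (r : ℝ) (x y : Fin n → ℍ[ℝ]) : form (r • x) y = r • form x y := by
  rw [real_smul_eq_op_smul, form_smul_left, MulOpposite.unop_op, Quaternion.star_coe,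
    Quaternion.coe_mul_eq_smul]

theorem form_nondegenerate {x : Fin n → ℍ[ℝ]} (h : ∀ y, form x y = 0) : x = 0 := by
  funext i
  have h1 := h (Pi.single i 1)
  simpa [form, jMat, Matrix.mulVec_diagonal, dotProduct, Pi.single_apply, jUnit_ne_zero] using h1

/-! ### Matrices as linear maps -/

/-- The linear map of right `ℍ`-vector spaces given by a matrix. -/
noncomputable def mulVecHom (A : Matrix (Fin n) (Fin n) ℍ[ℝ]) :
    (Fin n → ℍ[ℝ]) →ₗ[ℍ[ℝ]ᵐᵒᵖ] (Fin n → ℍ[ℝ]) where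
  toFun x := A *ᵥ x
  map_add' x y := Matrix.mulVec_add A x y
  map_smul' c x := Matrix.mulVec_smul A c x

@[simp] theorem mulVecHom_apply (A : Matrix (Fin n) (Fin n) ℍ[ℝ]) (x : Fin n → ℍ[ℝ]) :
    mulVecHom A x = A *ᵥ x := rfl

theorem sum_single_smul (x : Fin n → ℍ[ℝ]) :
    ∑ i, MulOpposite.op (x i) • (Pi.single i 1 : Fin n → ℍ[ℝ]) = x := by
  funext k
  simp [Finset.sum_apply, Pi.single_apply, MulOpposite.smul_eq_mul_unop]

theorem exists_matrix (f : (Fin n → ℍ[ℝ]) →ₗ[ℍ[ℝ]ᵐᵒᵖ] (Fin n → ℍ[ℝ])) :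
    ∃ A : Matrix (Fin n) (Fin n) ℍ[ℝ], ∀ x, A *ᵥ x = f x := by
  refine ⟨Matrix.of fun i k => f (Pi.single k 1) i, fun x => ?_⟩
  conv_rhs => rw [← sum_single_smul x, map_sum]
  funext i
  simp [Matrix.mulVec, dotProduct, MulOpposite.smul_eq_mul_unop]

theorem matrix_ext_mulVec {A B : Matrix (Fin n) (Fin n) ℍ[ℝ]} (h : ∀ x, A *ᵥ x = B *ᵥ x) :
    A = B := by
  ext1 i k
  have := congrFun (h (Pi.single k 1)) i
  simpa using this

theorem matrix_ext_of_span {ι : Type*} {b : ι → Fin n → ℍ[ℝ]}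
    (hb : Submodule.span ℍ[ℝ]ᵐᵒᵖ (Set.range b) = ⊤) {A B : Matrix (Fin n) (Fin n) ℍ[ℝ]}
    (h : ∀ k, A *ᵥ b k = B *ᵥ b k) : A = B :=
  matrix_ext_mulVec fun x => LinearMap.congr_fun
    (LinearMap.ext_on_range (f := mulVecHom A) (g := mulVecHom B) hb h) x

theorem form_ext_of_span {ι : Type*} {b : ι → Fin n → ℍ[ℝ]}
    (hb : Submodule.span ℍ[ℝ]ᵐᵒᵖ (Set.range b) = ⊤) {x y : Fin n → ℍ[ℝ]}
    (h : ∀ k, form (b k) x = form (b k) y) : x = y := by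
  have h0 : formRight (x - y) = 0 := LinearMap.ext_on_range hb fun k =>
    form_eq_zero_symm (by rw [form_sub_right, h, sub_self])
  exact sub_eq_zero.1 (form_nondegenerate fun z => LinearMap.congr_fun h0 z)

theorem form_mulVec_left (A : Matrix (Fin n) (Fin n) ℍ[ℝ]) (x y : Fin n → ℍ[ℝ]) :
    form (A *ᵥ x) y = star x ⬝ᵥ ((Aᴴ * jMat n) *ᵥ y) := by
  rw [form, Matrix.star_mulVec, ← Matrix.mulVec_mulVec, Matrix.dotProduct_mulVec,
    Matrix.dotProduct_mulVec, Matrix.dotProduct_mulVec]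

theorem form_mulVec_right (A : Matrix (Fin n) (Fin n) ℍ[ℝ]) (x y : Fin n → ℍ[ℝ]) :
    form x (A *ᵥ y) = star x ⬝ᵥ ((jMat n * A) *ᵥ y) := by
  rw [form, Matrix.mulVec_mulVec]

theorem matrix_ext_dotProduct {A B : Matrix (Fin n) (Fin n) ℍ[ℝ]}
    (h : ∀ x y, star x ⬝ᵥ (A *ᵥ y) = star x ⬝ᵥ (B *ᵥ y)) : A = B := by
  ext1 i k
  have := h (Pi.single i 1) (Pi.single k 1)
  simpa [Pi.star_single] using this

/-- The trace condition in `lieAlg` is automatic: the `imJ` component of the `(i, i)` entry of the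
relation is `2 Re (Z i i)`, and `trd Z` is twice the sum of these real parts. -/
theorem trd_eq_zero_of_skew {Z : Matrix (Fin n) (Fin n) ℍ[ℝ]}
    (h : Zᴴ * jMat n + jMat n * Z = 0) : trd Z = 0 := by
  have hre : ∀ i, (Z i i).re = 0 := fun i => by
    have h1 := congrArg QuaternionAlgebra.imJ (congrFun (congrFun h i) i)
    simp [jMat] at h1
    linarith
  simp [trd, toComplex, Matrix.trace, zPart, Complex.ext_iff, hre]

theorem mem_lieAlg_iff {Z : Matrix (Fin n) (Fin n) ℍ[ℝ]} :
    Z ∈ lieAlg n ↔ ∀ x y, form (Z *ᵥ x) y = -form x (Z *ᵥ y) := by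
  have key : ∀ x y, form (Z *ᵥ x) y + form x (Z *ᵥ y) =
      star x ⬝ᵥ ((Zᴴ * jMat n + jMat n * Z) *ᵥ y) := fun x y => by
    rw [form_mulVec_left, form_mulVec_right, Matrix.add_mulVec, dotProduct_add]
  constructor
  · intro h x y
    rw [eq_neg_iff_add_eq_zero, key, h.2]
    simp
  · intro h
    have h2 : Zᴴ * jMat n + jMat n * Z = 0 := matrix_ext_dotProduct fun x y => by
      rw [← key, h, neg_add_cancel]
      simp
    exact ⟨trd_eq_zero_of_skew h2, h2⟩

theorem mem_lieAlg_of_span {ι : Type*} {b : ι → Fin n → ℍ[ℝ]}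
    (hb : Submodule.span ℍ[ℝ]ᵐᵒᵖ (Set.range b) = ⊤) {Z : Matrix (Fin n) (Fin n) ℍ[ℝ]}
    (h : ∀ k k', form (Z *ᵥ b k) (b k') = -form (b k) (Z *ᵥ b k')) : Z ∈ lieAlg n := by
  have h1 : ∀ k y, form (Z *ᵥ b k) y = -form (b k) (Z *ᵥ y) := fun k y =>
    LinearMap.congr_fun (LinearMap.ext_on_range (f := formRight (Z *ᵥ b k))
      (g := -(formRight (b k) ∘ₗ mulVecHom Z)) hb (h k)) y
  rw [mem_lieAlg_iff]
  intro x y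
  -- The form is linear only in its second argument, so `star_form` swaps the arguments before the
  -- other variable is extended from the spanning family.
  have h2 : formRight (Z *ᵥ y) = -(formRight y ∘ₗ mulVecHom Z) :=
    LinearMap.ext_on_range hb fun k => by
      have := h1 k y
      change form (Z *ᵥ y) (b k) = -form y (Z *ᵥ b k)
      rw [← neg_neg (form (Z *ᵥ y) (b k)), ← star_form, ← star_form, ← star_neg, this]
  have h3 : form (Z *ᵥ y) x = -form y (Z *ᵥ x) := LinearMap.congr_fun h2 x
  rw [← neg_neg (form (Z *ᵥ x) y), ← star_form, ← star_form, ← star_neg, h3]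

theorem mem_group_of_span {ι : Type*} {b : ι → Fin n → ℍ[ℝ]}
    (hb : Submodule.span ℍ[ℝ]ᵐᵒᵖ (Set.range b) = ⊤) {g : (Matrix (Fin n) (Fin n) ℍ[ℝ])ˣ}
    (hg : nrd g.val = 1)
    (h : ∀ k k', form (g.val *ᵥ b k) (g.val *ᵥ b k') = form (b k) (b k')) : g ∈ group n := by
  refine ⟨hg, matrix_ext_of_span hb fun k' => ?_⟩
  have hJ : jMat n * -jMat n = 1 := by
    rw [jMat, mul_neg, Matrix.diagonal_mul_diagonal]
    simp [jUnit_mul_jUnit]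
  -- Because `J * (-J) = 1`, the matrix `-J gᴴ J` is the adjoint of `g` for the form; preserving the
  -- form means that it is a left inverse of `g`.
  have key : (-jMat n * g.valᴴ * jMat n * g.val) *ᵥ b k' = b k' := by
    refine form_ext_of_span hb fun k => ?_
    rw [form_mulVec_right, ← h, form_mulVec_left, Matrix.mulVec_mulVec]
    simp only [← mul_assoc, hJ, one_mul]
  calc (g.valᴴ * jMat n * g.val) *ᵥ b k'
      = jMat n *ᵥ ((-jMat n * g.valᴴ * jMat n * g.val) *ᵥ b k') := by
        rw [Matrix.mulVec_mulVec]
        simp only [← mul_assoc, hJ, one_mul]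
    _ = _ := by rw [key]

theorem form_group {g : (Matrix (Fin n) (Fin n) ℍ[ℝ])ˣ} (hg : g ∈ group n)
    (x y : Fin n → ℍ[ℝ]) : form (g.val *ᵥ x) (g.val *ᵥ y) = form x y := by
  rw [form_mulVec_left, Matrix.mulVec_mulVec, hg.2, form]

/-! ### Skew-adjoint matrices -/

theorem pow_mulVec_pow_mulVec (X : Matrix (Fin n) (Fin n) ℍ[ℝ]) (k l : ℕ) (x : Fin n → ℍ[ℝ]) :
    X ^ k *ᵥ (X ^ l *ᵥ x) = X ^ (k + l) *ᵥ x := by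
  rw [Matrix.mulVec_mulVec, pow_add]

theorem mulVec_pow_mulVec (X : Matrix (Fin n) (Fin n) ℍ[ℝ]) (l : ℕ) (x : Fin n → ℍ[ℝ]) :
    X *ᵥ (X ^ l *ᵥ x) = X ^ (l + 1) *ᵥ x := by
  rw [Matrix.mulVec_mulVec, pow_succ']

theorem form_pow_left {X : Matrix (Fin n) (Fin n) ℍ[ℝ]} (hX : X ∈ lieAlg n) (l : ℕ)
    (x y : Fin n → ℍ[ℝ]) : form (X ^ l *ᵥ x) y = (-1 : ℝ) ^ l • form x (X ^ l *ᵥ y) := by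
  induction l generalizing x with
  | zero => simp
  | succ l ih =>
    have h : X ^ (l + 1) *ᵥ x = X ^ l *ᵥ (X *ᵥ x) := by rw [Matrix.mulVec_mulVec, pow_succ]
    rw [h, ih, mem_lieAlg_iff.1 hX, mulVec_pow_mulVec, pow_succ (-1 : ℝ),
      mul_neg_one, smul_neg, neg_smul]

theorem form_pow_pow {X : Matrix (Fin n) (Fin n) ℍ[ℝ]} (hX : X ∈ lieAlg n) (l m : ℕ)
    (x y : Fin n → ℍ[ℝ]) :
    form (X ^ l *ᵥ x) (X ^ m *ᵥ y) = (-1 : ℝ) ^ l • form x (X ^ (l + m) *ᵥ y) := by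
  rw [form_pow_left hX, pow_mulVec_pow_mulVec]

/-- Source of the parity dichotomy: the form `⟨x, X ^ l y⟩` is Hermitian for odd `l` and
skew-Hermitian for even `l`, which is why only rows of even length carry signs. -/
theorem star_form_pow {X : Matrix (Fin n) (Fin n) ℍ[ℝ]} (hX : X ∈ lieAlg n) (l : ℕ)
    (x y : Fin n → ℍ[ℝ]) :
    star (form x (X ^ l *ᵥ y)) = -((-1 : ℝ) ^ l • form y (X ^ l *ᵥ x)) := by
  rw [star_form, form_pow_left hX]

/-! ### Normalizing values of (skew-)Hermitian forms -/

theorem exists_star_mul_mul_of_star_eq {q : ℍ[ℝ]} (hq : q ≠ 0) (h : star q = q) :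
    ∃ a : ℍ[ℝ], star a * q * a = 1 ∨ star a * q * a = -1 := by
  obtain ⟨r, rfl⟩ : ∃ r : ℝ, q = r := ⟨q.re, Quaternion.star_eq_self.1 h⟩
  have hr : r ≠ 0 := by
    rintro rfl
    simp at hq
  have hs : √|r| * √|r| = |r| := Real.mul_self_sqrt (abs_nonneg r)
  have hs0 : √|r| ≠ 0 := (Real.sqrt_pos.2 (abs_pos.2 hr)).ne'
  refine ⟨((√|r|)⁻¹ : ℝ), ?_⟩
  rw [Quaternion.star_coe, ← Quaternion.coe_mul, ← Quaternion.coe_mul]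
  have hcalc : (√|r|)⁻¹ * r * (√|r|)⁻¹ = r / |r| := by
    rw [div_eq_mul_inv, ← congrArg (·⁻¹) hs, mul_inv]
    ring
  rw [hcalc]
  rcases lt_or_gt_of_ne hr with h | h
  · right
    rw [abs_of_neg h, div_neg, div_self hr]
    simp
  · left
    rw [abs_of_pos h, div_self hr]
    simp

/-- A pure quaternion of norm `s` is conjugate to `s j`: if `q b = s b j` with `b ≠ 0`, then `star b
* q * b` is a positive multiple of `j`, and a real rescaling finishes. -/
theorem exists_star_mul_mul_of_star_eq_neg {q : ℍ[ℝ]} (hq : q ≠ 0) (h : star q = -q) :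
    ∃ a : ℍ[ℝ], star a * q * a = jUnit := by
  obtain ⟨b, hb0, s, hs, hb⟩ : ∃ b : ℍ[ℝ], b ≠ 0 ∧ ∃ s : ℝ, 0 < s ∧ q * b = s • (b * jUnit) := by
    set s : ℝ := √(Quaternion.normSq q) with hsdef
    have hN : 0 < Quaternion.normSq q :=
      lt_of_le_of_ne Quaternion.normSq_nonneg fun h => hq (Quaternion.normSq_eq_zero.1 h.symm)
    have hs : 0 < s := Real.sqrt_pos.2 hN
    have hqq : q * q = -((s * s : ℝ) : ℍ[ℝ]) := by
      have := Quaternion.self_mul_star q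
      rw [h, mul_neg] at this
      rw [Real.mul_self_sqrt hN.le, ← this, neg_neg]
    -- The conjugator is `s - q j`, by `q * q = -s²`. It vanishes only for `q = -s j`, where `b = i`
    -- works because `i` anticommutes with `j`.
    by_cases hb : s • (1 : ℍ[ℝ]) - q * jUnit = 0
    · have hqj : q = -(s • jUnit) := by
        have h1 : q * jUnit = s • 1 := (sub_eq_zero.1 hb).symm
        have h2 := congrArg (· * jUnit) h1
        simp only [mul_assoc, jUnit_mul_jUnit, smul_mul_assoc, one_mul] at h2
        rw [← h2]
        simp
      obtain ⟨b, hb, hbj⟩ : ∃ b : ℍ[ℝ], b.imI = 1 ∧ -(jUnit * b) = b * jUnit := by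
        let b : ℍ[ℝ] := ⟨0, 1, 0, 0⟩
        have h0 : b.re = 0 := rfl
        have h1 : b.imI = 1 := rfl
        have h2 : b.imJ = 0 := rfl
        have h3 : b.imK = 0 := rfl
        exact ⟨b, h1, by ext <;> simp [h0, h1, h2, h3]⟩
      refine ⟨b, fun h => by simp [h] at hb, s, hs, ?_⟩
      rw [hqj, neg_mul, smul_mul_assoc, ← smul_neg, hbj]
    · refine ⟨_, hb, s, hs, ?_⟩
      rw [mul_sub, sub_mul, ← mul_assoc, hqq, smul_sub, mul_assoc q, jUnit_mul_jUnit]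
      simp [sub_eq_add_neg, add_comm, Quaternion.coe_mul_eq_smul]
  have hN : 0 < Quaternion.normSq b :=
    lt_of_le_of_ne Quaternion.normSq_nonneg fun h => hb0 (Quaternion.normSq_eq_zero.1 h.symm)
  obtain ⟨r, hr, h1⟩ : ∃ r : ℝ, 0 < r ∧ star b * q * b = r • jUnit := by
    refine ⟨s * Quaternion.normSq b, mul_pos hs hN, ?_⟩
    rw [mul_assoc, hb, mul_smul_comm, ← mul_assoc, Quaternion.star_mul_self, mul_smul,
      Quaternion.coe_mul_eq_smul]
  refine ⟨(√r)⁻¹ • b, ?_⟩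
  have hss : √r * √r = r := Real.mul_self_sqrt hr.le
  have hs0 : √r ≠ 0 := (Real.sqrt_pos.2 hr).ne'
  rw [Quaternion.star_smul, smul_mul_assoc, smul_mul_assoc, mul_smul_comm, h1, smul_smul,
    smul_smul]
  have : (√r)⁻¹ * (√r)⁻¹ * r = 1 := by
    nth_rw 3 [← hss]
    field_simp
  rw [this, one_smul]

/-! ### Splitting off one Jordan chain -/

/-- Polarization. If all diagonal values vanished, then `q = (-1) ^ m star q` for every value `q =
⟨y, X ^ m z⟩`. Rescaling `x` makes `q` an arbitrary quaternion, and `q = j` (even `m`) or `q = 1`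
(odd `m`) is a contradiction. -/
theorem exists_form_pow_self_ne_zero {X : Matrix (Fin n) (Fin n) ℍ[ℝ]} (hX : X ∈ lieAlg n)
    {U : Submodule ℍ[ℝ]ᵐᵒᵖ (Fin n → ℍ[ℝ])} {m : ℕ} {x y : Fin n → ℍ[ℝ]} (hx : x ∈ U)
    (hy : y ∈ U) (hxy : form y (X ^ m *ᵥ x) ≠ 0) : ∃ v ∈ U, form v (X ^ m *ᵥ v) ≠ 0 := by
  by_contra! hcon
  have key : ∀ q : ℍ[ℝ], q - (-1 : ℝ) ^ m • star q = 0 := fun q => by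
    set c := (form y (X ^ m *ᵥ x))⁻¹ * q
    have hz : MulOpposite.op c • x ∈ U := U.smul_mem _ hx
    have hq : form y (X ^ m *ᵥ (MulOpposite.op c • x)) = q := by
      rw [Matrix.mulVec_smul, form_smul_right, MulOpposite.unop_op, mul_inv_cancel_left₀ hxy]
    have h1 := hcon _ (U.add_mem hy hz)
    rw [Matrix.mulVec_add, form_add_left, form_add_right, form_add_right, hcon _ hy, hcon _ hz,
      hq] at h1
    have h2 := star_form_pow hX m y (MulOpposite.op c • x)
    rw [hq] at h2
    rw [h2, smul_neg, smul_smul, ← mul_pow]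
    simpa using h1
  rcases neg_one_pow_eq_or ℝ m with h | h <;> rw [h] at key
  · have := key jUnit
    rw [star_jUnit, one_smul, sub_neg_eq_add] at this
    have := congrArg QuaternionAlgebra.imJ this
    norm_num at this
  · have := key 1
    rw [star_one, neg_one_smul, sub_neg_eq_add] at this
    have h2 : (1 + 1 : ℍ[ℝ]).re = 0 := by rw [this, Quaternion.re_zero]
    rw [Quaternion.re_add, Quaternion.re_one] at h2
    norm_num at h2

theorem exists_form_pow_normalized {X : Matrix (Fin n) (Fin n) ℍ[ℝ]} (hX : X ∈ lieAlg n)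
    {U : Submodule ℍ[ℝ]ᵐᵒᵖ (Fin n → ℍ[ℝ])} {m : ℕ} {v : Fin n → ℍ[ℝ]} (hv : v ∈ U)
    (hne : form v (X ^ m *ᵥ v) ≠ 0) : ∃ w ∈ U,
      (Odd m → form w (X ^ m *ᵥ w) = 1 ∨ form w (X ^ m *ᵥ w) = -1) ∧
      (Even m → form w (X ^ m *ᵥ w) = jUnit) := by
  have hs := star_form_pow hX m v v
  have hw : ∀ a : ℍ[ℝ], form (MulOpposite.op a • v) (X ^ m *ᵥ (MulOpposite.op a • v)) =
      star a * form v (X ^ m *ᵥ v) * a := fun a => by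
    rw [Matrix.mulVec_smul, form_smul_right, form_smul_left, MulOpposite.unop_op]
  rcases Nat.even_or_odd m with hm | hm
  · rw [hm.neg_one_pow, one_smul] at hs
    obtain ⟨a, ha⟩ := exists_star_mul_mul_of_star_eq_neg hne hs
    refine ⟨_, U.smul_mem (MulOpposite.op a) hv, fun h => ?_, fun _ => ?_⟩
    · exact absurd hm (Nat.not_even_iff_odd.2 h)
    · rw [hw, ha]
  · rw [hm.neg_one_pow, neg_smul, one_smul, neg_neg] at hs
    obtain ⟨a, ha⟩ := exists_star_mul_mul_of_star_eq hne hs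
    refine ⟨_, U.smul_mem (MulOpposite.op a) hv, fun _ => ?_, fun h => ?_⟩
    · rwa [hw]
    · exact absurd h (Nat.not_even_iff_odd.2 hm)

theorem pow_mulVec_mem {X : Matrix (Fin n) (Fin n) ℍ[ℝ]}
    {U : Submodule ℍ[ℝ]ᵐᵒᵖ (Fin n → ℍ[ℝ])} (hU : ∀ x ∈ U, X *ᵥ x ∈ U) (k : ℕ)
    {x : Fin n → ℍ[ℝ]} (hx : x ∈ U) : X ^ k *ᵥ x ∈ U := by
  induction k with
  | zero => simpa using hx
  | succ k ih =>
    rw [← mulVec_pow_mulVec]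
    exact hU _ ih

theorem pow_mulVec_eq_zero_of_le {X : Matrix (Fin n) (Fin n) ℍ[ℝ]} {k l : ℕ}
    {x : Fin n → ℍ[ℝ]} (h : X ^ k *ᵥ x = 0) (hkl : k ≤ l) : X ^ l *ᵥ x = 0 := by
  obtain ⟨i, rfl⟩ := Nat.exists_eq_add_of_le' hkl
  rw [← pow_mulVec_pow_mulVec, h, Matrix.mulVec_zero]

/-- Downward induction on the exponent: adding a right multiple of `X ^ (k + 1) v` kills `⟨v, X ^ (m
- k - 1) v⟩`. For larger exponents all correction terms contain a power of `X` beyond `m`, so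
nothing already achieved is disturbed. -/
theorem exists_orthogonal_chain {X : Matrix (Fin n) (Fin n) ℍ[ℝ]} (hX : X ∈ lieAlg n)
    {U : Submodule ℍ[ℝ]ᵐᵒᵖ (Fin n → ℍ[ℝ])} (hU : ∀ x ∈ U, X *ᵥ x ∈ U) {m : ℕ}
    (hpow : ∀ x ∈ U, X ^ (m + 1) *ᵥ x = 0) {w : Fin n → ℍ[ℝ]} (hw : w ∈ U)
    (hne : form w (X ^ m *ᵥ w) ≠ 0) : ∃ v ∈ U, form v (X ^ m *ᵥ v) = form w (X ^ m *ᵥ w) ∧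
      ∀ i < m, form v (X ^ i *ᵥ v) = 0 := by
  set ε := form w (X ^ m *ᵥ w) with hε
  suffices H : ∀ k, ∃ v ∈ U, form v (X ^ m *ᵥ v) = ε ∧
      ∀ i < m, m ≤ i + k → form v (X ^ i *ᵥ v) = 0 by
    obtain ⟨v, hv, h1, h2⟩ := H m
    exact ⟨v, hv, h1, fun i hi => h2 i hi (Nat.le_add_left m i)⟩
  intro k
  induction k with
  | zero => exact ⟨w, hw, rfl, fun i hi hi' => by omega⟩
  | succ k ih =>
    obtain ⟨v, hv, h1, h2⟩ := ih
    by_cases hkm : m < k + 1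
    · exact ⟨v, hv, h1, fun i hi _ => h2 i hi (by omega)⟩
    obtain ⟨i₀, hi₀⟩ : ∃ i₀, i₀ + (k + 1) = m := ⟨m - (k + 1), by omega⟩
    set f := form v (X ^ i₀ *ᵥ v) with hf
    -- The factor `1/2` appears because the two cross terms are equal: both are `-f / 2`, by the
    -- symmetry of `ε` and `f` under `star`. The quadratic term vanishes, its exponent exceeding
    -- `m`.
    set a := -(ε⁻¹ * ((2 : ℝ)⁻¹ • f)) with ha
    have hbig : ∀ i, m < i → form v (X ^ i *ᵥ v) = 0 := fun i hi => by
      rw [pow_mulVec_eq_zero_of_le (hpow v hv) hi, form_zero_right]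
    have expand : ∀ i, form (v + MulOpposite.op a • (X ^ (k + 1) *ᵥ v))
        (X ^ i *ᵥ (v + MulOpposite.op a • (X ^ (k + 1) *ᵥ v))) =
        form v (X ^ i *ᵥ v) + form v (X ^ (i + (k + 1)) *ᵥ v) * a +
        (star a * ((-1 : ℝ) ^ (k + 1) • form v (X ^ (i + (k + 1)) *ᵥ v)) +
        star a * ((-1 : ℝ) ^ (k + 1) • form v (X ^ (i + (k + 1) + (k + 1)) *ᵥ v)) * a) :=
      fun i => by
        rw [Matrix.mulVec_add, Matrix.mulVec_smul, form_add_left, form_add_right,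
          form_add_right, form_smul_right, form_smul_left, form_smul_right, form_smul_left,
          pow_mulVec_pow_mulVec, form_pow_pow hX, form_pow_pow hX, MulOpposite.unop_op,
          add_comm (k + 1) i, show k + 1 + (i + (k + 1)) = i + (k + 1) + (k + 1) by ring]
    refine ⟨v + MulOpposite.op a • (X ^ (k + 1) *ᵥ v),
      U.add_mem hv (U.smul_mem _ (pow_mulVec_mem hU _ hv)), ?_, fun i hi hi' => ?_⟩
    · rw [expand, hbig (m + (k + 1)) (by omega), hbig (m + (k + 1) + (k + 1)) (by omega), h1]
      simp
    · rw [expand, hbig (i + (k + 1) + (k + 1)) (by omega)]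
      rcases hi'.eq_or_lt with h | h
      · obtain rfl : i = i₀ := by omega
        rw [← h, h1, ← hf]
        have e1 : ε * a = -((2 : ℝ)⁻¹ • f) := by
          rw [ha, mul_neg, mul_inv_cancel_left₀ hne]
        have hsf : star f = -((-1 : ℝ) ^ i • f) := star_form_pow hX i v v
        have hsε : star ε = -((-1 : ℝ) ^ m • ε) := star_form_pow hX m w w
        have e2 : star a * ε = (-1 : ℝ) ^ (k + 1) • -((2 : ℝ)⁻¹ • f) := by
          have h3 : star (ε * a) = -((-1 : ℝ) ^ m • (star a * ε)) := by
            rw [star_mul, hsε, mul_neg, mul_smul_comm]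
          have h4 : star (ε * a) = (-1 : ℝ) ^ i • ((2 : ℝ)⁻¹ • f) := by
            rw [e1, star_neg, Quaternion.star_smul, hsf, smul_neg, neg_neg, smul_comm]
          rw [h4] at h3
          have h5 := congrArg (fun z => -((-1 : ℝ) ^ m • z)) h3
          simp only [smul_neg, neg_neg, smul_smul, ← mul_pow] at h5
          rw [neg_one_mul, neg_neg, one_pow, one_smul] at h5
          rw [← h5, smul_neg, smul_smul, ← mul_assoc, h, pow_add]
          rcases neg_one_pow_eq_or ℝ i with h | h <;> simp [h]
        rw [mul_smul_comm, e1, e2, smul_smul, ← mul_pow]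
        simp only [smul_zero, mul_zero, zero_mul, add_zero, neg_one_mul, neg_neg, one_pow,
          one_smul]
        have : f = (2 : ℝ)⁻¹ • f + (2 : ℝ)⁻¹ • f := by
          rw [← add_smul]
          norm_num
        nth_rw 1 [this]
        abel
      · rw [h2 i hi (by omega), hbig (i + (k + 1)) h]
        simp

instance finite_mulOpposite : Module.Finite ℍ[ℝ]ᵐᵒᵖ ℍ[ℝ] :=
  Module.Finite.equiv (MulOpposite.opLinearEquiv ℍ[ℝ]ᵐᵒᵖ : ℍ[ℝ] ≃ₗ[ℍ[ℝ]ᵐᵒᵖ] ℍ[ℝ]ᵐᵒᵖ).symm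

theorem finrank_mulOpposite : Module.finrank ℍ[ℝ]ᵐᵒᵖ ℍ[ℝ] = 1 := by
  rw [(MulOpposite.opLinearEquiv ℍ[ℝ]ᵐᵒᵖ : ℍ[ℝ] ≃ₗ[ℍ[ℝ]ᵐᵒᵖ] ℍ[ℝ]ᵐᵒᵖ).finrank_eq,
    Module.finrank_self]

theorem finrank_pi : Module.finrank ℍ[ℝ]ᵐᵒᵖ (Fin n → ℍ[ℝ]) = n := by
  rw [Module.finrank_pi_fintype]
  simp [finrank_mulOpposite]

/-- Here `m + 1` is the nilpotency index of `X` on `U`; nondegeneracy on `U` then makes `⟨y, X ^ m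
x⟩` nonzero for some `x` and `y` in `U`. -/
theorem exists_normalized_chain {X : Matrix (Fin n) (Fin n) ℍ[ℝ]} (hX : X ∈ lieAlg n)
    (hnil : IsNilpotent X) {U : Submodule ℍ[ℝ]ᵐᵒᵖ (Fin n → ℍ[ℝ])} (hU : ∀ x ∈ U, X *ᵥ x ∈ U)
    (hnd : ∀ x ∈ U, (∀ y ∈ U, form x y = 0) → x = 0) (hbot : U ≠ ⊥) :
    ∃ (m : ℕ) (v : Fin n → ℍ[ℝ]), v ∈ U ∧ X ^ (m + 1) *ᵥ v = 0 ∧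
      (∀ i, i ≠ m → form v (X ^ i *ᵥ v) = 0) ∧
      (Odd m → form v (X ^ m *ᵥ v) = 1 ∨ form v (X ^ m *ᵥ v) = -1) ∧
      (Even m → form v (X ^ m *ᵥ v) = jUnit) := by
  have hex : ∃ k, ∀ x ∈ U, X ^ k *ᵥ x = 0 := by
    obtain ⟨k, hk⟩ := hnil
    exact ⟨k, fun x _ => by rw [hk, Matrix.zero_mulVec]⟩
  classical
  obtain ⟨m, hm⟩ : ∃ m, Nat.find hex = m + 1 := by
    refine Nat.exists_eq_succ_of_ne_zero fun h0 => hbot ?_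
    have := Nat.find_spec hex
    rw [h0] at this
    exact (Submodule.eq_bot_iff U).2 fun x hx => by simpa using this x hx
  have hpow : ∀ x ∈ U, X ^ (m + 1) *ᵥ x = 0 := hm ▸ Nat.find_spec hex
  have hmin := Nat.find_min hex (show m < Nat.find hex by omega)
  push Not at hmin
  obtain ⟨x, hx, hx0⟩ := hmin
  obtain ⟨y, hy, hxy⟩ : ∃ y ∈ U, form (X ^ m *ᵥ x) y ≠ 0 := by
    by_contra! hcon
    exact hx0 (hnd _ (pow_mulVec_mem hU m hx) hcon)
  obtain ⟨u, hu, hu0⟩ := exists_form_pow_self_ne_zero hX hx hy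
    (fun h => hxy (form_eq_zero_symm h))
  obtain ⟨w, hw, hodd, heven⟩ := exists_form_pow_normalized hX hu hu0
  have hw0 : form w (X ^ m *ᵥ w) ≠ 0 := by
    rcases Nat.even_or_odd m with h | h
    · rw [heven h]
      exact jUnit_ne_zero
    · rcases hodd h with h | h <;> rw [h] <;> simp
  obtain ⟨v, hv, hvw, hv0⟩ := exists_orthogonal_chain hX hU hpow hw hw0
  refine ⟨m, v, hv, hpow v hv, fun i hi => ?_, ?_, ?_⟩
  · rcases lt_or_gt_of_ne hi with h | h
    · exact hv0 i h
    · rw [pow_mulVec_eq_zero_of_le (hpow v hv) h, form_zero_right]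
  · rwa [hvw]
  · rwa [hvw]

/-- A family of orthogonal normalized Jordan chains `X ^ l v i`, `l < d i`, that spans `U`. -/
structure IsFrame (X : Matrix (Fin n) (Fin n) ℍ[ℝ]) (U : Submodule ℍ[ℝ]ᵐᵒᵖ (Fin n → ℍ[ℝ]))
    {ι : Type} (d : ι → ℕ) (v : ι → Fin n → ℍ[ℝ]) : Prop where
  pos : ∀ i, 0 < d i
  mem : ∀ i, v i ∈ U
  pow_eq_zero : ∀ i, X ^ d i *ᵥ v i = 0
  form_eq_zero : ∀ i i' (l l' : ℕ), ¬ (i = i' ∧ l + l' + 1 = d i) →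
    form (X ^ l *ᵥ v i) (X ^ l' *ᵥ v i') = 0
  form_even : ∀ i, Even (d i) →
    form (v i) (X ^ (d i - 1) *ᵥ v i) = 1 ∨ form (v i) (X ^ (d i - 1) *ᵥ v i) = -1
  form_odd : ∀ i, Odd (d i) → form (v i) (X ^ (d i - 1) *ᵥ v i) = jUnit
  le_span : U ≤ Submodule.span ℍ[ℝ]ᵐᵒᵖ
    (Set.range fun b : (i : ι) × Fin (d i) => X ^ (b.2 : ℕ) *ᵥ v b.1)

/-- Well-founded induction on `U`: split off one chain of maximal length and pass to its orthogonal
complement `U'` in `U`, which is again `X`-stable and nondegenerate. -/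
theorem exists_frame {X : Matrix (Fin n) (Fin n) ℍ[ℝ]} (hX : X ∈ lieAlg n)
    (hnil : IsNilpotent X) (U : Submodule ℍ[ℝ]ᵐᵒᵖ (Fin n → ℍ[ℝ])) :
    (∀ x ∈ U, X *ᵥ x ∈ U) → (∀ x ∈ U, (∀ y ∈ U, form x y = 0) → x = 0) →
    ∃ (ι : Type) (_ : Finite ι) (d : ι → ℕ) (v : ι → Fin n → ℍ[ℝ]), IsFrame X U d v := by
  induction U using WellFoundedLT.induction with
  | ind U ih =>
  intro hU hnd
  by_cases hbot : U = ⊥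
  · exact ⟨Empty, inferInstance, Empty.elim, Empty.elim, by
      constructor <;> simp [hbot]⟩
  obtain ⟨m, v, hv, hpow, hv0, hodd, heven⟩ := exists_normalized_chain hX hnil hU hnd hbot
  have hvm : form v (X ^ m *ᵥ v) ≠ 0 := by
    rcases Nat.even_or_odd m with h | h
    · rw [heven h]
      exact jUnit_ne_zero
    · rcases hodd h with h | h <;> rw [h] <;> simp
  have hchain : ∀ l l', l + l' ≠ m → form (X ^ l *ᵥ v) (X ^ l' *ᵥ v) = 0 := fun l l' h => by
    rw [form_pow_pow hX, hv0 _ h, smul_zero]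
  let U' : Submodule ℍ[ℝ]ᵐᵒᵖ (Fin n → ℍ[ℝ]) :=
    { carrier := {x | x ∈ U ∧ ∀ l, form (X ^ l *ᵥ v) x = 0}
      zero_mem' := ⟨U.zero_mem, fun l => form_zero_right _⟩
      add_mem' := fun ha hb => ⟨U.add_mem ha.1 hb.1, fun l => by
        rw [form_add_right, ha.2, hb.2, add_zero]⟩
      smul_mem' := fun c x hx => ⟨U.smul_mem c hx.1, fun l => by
        rw [form_smul_right, hx.2, zero_mul]⟩ }
  have hmem : ∀ x, x ∈ U' ↔ x ∈ U ∧ ∀ l, form (X ^ l *ᵥ v) x = 0 := fun x => Iff.rfl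
  have hU'U : U' ≤ U := fun x hx => hx.1
  have hlt : U' < U := by
    refine lt_of_le_of_ne hU'U fun h => ?_
    have h1 : form (X ^ m *ᵥ v) v = 0 := ((hmem v).1 (h ▸ hv)).2 m
    exact hvm (form_eq_zero_symm h1)
  -- Orthogonal projection off the chain. Its Gram matrix is antidiagonal with nonzero entries, so
  -- pairing with `X ^ (m - l) v` isolates the coefficient of `X ^ l v`.
  have hproj : ∀ y ∈ U, ∃ c : Fin (m + 1) → ℍ[ℝ]ᵐᵒᵖ,
      y - ∑ l, c l • (X ^ (l : ℕ) *ᵥ v) ∈ U' := fun y hy => by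
    have hne : ∀ l : Fin (m + 1), form (X ^ (m - (l : ℕ)) *ᵥ v) (X ^ (l : ℕ) *ᵥ v) ≠ 0 :=
      fun l => by
        rw [form_pow_pow hX, Nat.sub_add_cancel (Nat.lt_succ_iff.1 l.2)]
        exact smul_ne_zero (pow_ne_zero _ (by norm_num)) hvm
    refine ⟨fun l => MulOpposite.op ((form (X ^ (m - (l : ℕ)) *ᵥ v) (X ^ (l : ℕ) *ᵥ v))⁻¹ *
      form (X ^ (m - (l : ℕ)) *ᵥ v) y), ?_⟩
    refine ⟨U.sub_mem hy (U.sum_mem fun l _ => U.smul_mem _ (pow_mulVec_mem hU _ hv)),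
      fun l => ?_⟩
    rcases Nat.lt_or_ge m l with h | h
    · rw [pow_mulVec_eq_zero_of_le hpow h, form_zero_left]
    rw [form_sub_right, form_sum_right, Finset.sum_eq_single ⟨m - l, by omega⟩]
    · have : m - (m - l) = l := by omega
      have hl := hne ⟨m - l, by omega⟩
      simp only [this] at hl ⊢
      rw [form_smul_right, MulOpposite.unop_op, mul_inv_cancel_left₀ hl, sub_self]
    · intro b _ hb
      rw [form_smul_right, hchain, zero_mul]
      intro hlb
      exact hb (Fin.ext (by simp only; omega))
    · simp
  obtain ⟨ι, hι, d, w, hw⟩ := ih U' hlt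
    (fun x hx => ⟨hU x hx.1, fun l => by
      rw [← neg_neg (form _ _), ← mem_lieAlg_iff.1 hX, mulVec_pow_mulVec, hx.2, neg_zero]⟩)
    (fun x hx h => hnd x hx.1 fun y hy => by
      obtain ⟨c, hc⟩ := hproj y hy
      have h1 := h _ hc
      rw [form_sub_right, form_sum_right, Finset.sum_eq_zero, sub_zero] at h1
      · exact h1
      · intro l _
        rw [form_smul_right, form_eq_zero_symm (hx.2 l), zero_mul])
  have horth : ∀ i l l', form (X ^ l *ᵥ v) (X ^ l' *ᵥ w i) = 0 := fun i l l' => by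
    rw [form_pow_pow hX, ← neg_one_smul ℝ, ← neg_one_smul ℝ]
    have := (hw.mem i).2 (l + l')
    rw [form_pow_left hX] at this
    rw [(smul_eq_zero.1 this).resolve_left (pow_ne_zero _ (by norm_num))]
    simp
  refine ⟨Option ι, inferInstance, fun o => o.elim (m + 1) d, fun o => o.elim v w, ?_⟩
  constructor
  · rintro (_ | i)
    · exact m.succ_pos
    · exact hw.pos i
  · rintro (_ | i)
    · exact hv
    · exact hU'U (hw.mem i)
  · rintro (_ | i)
    · exact hpow
    · exact hw.pow_eq_zero i
  · rintro (_ | i) (_ | i') l l' h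
    · exact hchain l l' fun h' => h ⟨rfl, congrArg (· + 1) h'⟩
    · exact horth i' l l'
    · exact form_eq_zero_symm (horth i l' l)
    · exact hw.form_eq_zero i i' l l' fun h' => h ⟨congrArg some h'.1, h'.2⟩
  · rintro (_ | i) h
    · exact hodd (by simpa [Nat.even_add_one] using h)
    · exact hw.form_even i h
  · rintro (_ | i) h
    · exact heven (by simpa [Nat.odd_add_one] using h)
    · exact hw.form_odd i h
  · intro y hy
    obtain ⟨c, hc⟩ := hproj y hy
    rw [← sub_add_cancel y (∑ l, c l • (X ^ (l : ℕ) *ᵥ v))]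
    refine Submodule.add_mem _ ?_ (Submodule.sum_mem _ fun l _ => Submodule.smul_mem _ _ ?_)
    · refine Submodule.span_mono ?_ (hw.le_span hc)
      rintro _ ⟨b, rfl⟩
      exact ⟨⟨some b.1, b.2⟩, rfl⟩
    · exact Submodule.subset_span ⟨⟨none, l⟩, rfl⟩

/-! ### Bases of Jordan chains -/

theorem linearIndependent_of_dual {κ : Type*} {b b' : κ → Fin n → ℍ[ℝ]}
    (h : ∀ k, form (b' k) (b k) ≠ 0) (h0 : ∀ k k', k ≠ k' → form (b' k) (b k') = 0) :
    LinearIndependent ℍ[ℝ]ᵐᵒᵖ b := by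
  rw [linearIndependent_iff']
  intro s c hc k hk
  have h1 := congrArg (form (b' k)) hc
  rw [form_sum_right, form_zero_right, Finset.sum_eq_single_of_mem k hk, form_smul_right] at h1
  · exact MulOpposite.unop_injective ((mul_eq_zero.1 h1).resolve_left (h k))
  · intro k' _ hk'
    rw [form_smul_right, h0 k k' hk'.symm, zero_mul]

/-- The part of `IsAdaptedBasis` that does not involve an `sl₂`-triple. -/
structure IsChainBasis (X : Matrix (Fin n) (Fin n) ℍ[ℝ]) (t : ℕ → ℕ)
    (v : (d : ℕ) → Fin (t d) → Fin n → ℍ[ℝ]) : Prop where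
  mem_lieAlg : X ∈ lieAlg n
  pow_eq_zero : ∀ d (j : Fin (t d)), X ^ d *ᵥ v d j = 0
  linearIndependent : LinearIndependent ℍ[ℝ]ᵐᵒᵖ
    (fun b : (d : ℕ) × (Fin (t d) × Fin d) => X ^ (b.2.2 : ℕ) *ᵥ v b.1 b.2.1)
  span_eq_top : Submodule.span ℍ[ℝ]ᵐᵒᵖ (Set.range
    (fun b : (d : ℕ) × (Fin (t d) × Fin d) => X ^ (b.2.2 : ℕ) *ᵥ v b.1 b.2.1)) = ⊤
  form_eq_zero : ∀ d d' (j : Fin (t d)) (j' : Fin (t d')) (l l' : ℕ), l < d → l' < d' →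
    ¬ (d = d' ∧ (j : ℕ) = (j' : ℕ) ∧ l + l' + 1 = d) →
      form (X ^ l *ᵥ v d j) (X ^ l' *ᵥ v d' j') = 0
  form_even : ∀ d (j : Fin (t d)), Even d →
    form (v d j) (X ^ (d - 1) *ᵥ v d j) = 1 ∨ form (v d j) (X ^ (d - 1) *ᵥ v d j) = -1
  form_odd : ∀ d (j : Fin (t d)), Odd d → form (v d j) (X ^ (d - 1) *ᵥ v d j) = jUnit

theorem IsAdaptedBasis.isChainBasis {X H Y : Matrix (Fin n) (Fin n) ℍ[ℝ]} {t : ℕ → ℕ}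
    {v : (d : ℕ) → Fin (t d) → Fin n → ℍ[ℝ]} (h : IsAdaptedBasis X H Y t v)
    (hX : X ∈ lieAlg n) : IsChainBasis X t v :=
  ⟨hX, h.pow_eq_zero, h.linearIndependent, h.span_eq_top, h.form_eq_zero, h.form_even, h.form_odd⟩

namespace IsChainBasis

variable {X : Matrix (Fin n) (Fin n) ℍ[ℝ]} {t : ℕ → ℕ}
  {v : (d : ℕ) → Fin (t d) → Fin n → ℍ[ℝ]}

theorem form_ne_zero (h : IsChainBasis X t v) (d : ℕ) (j : Fin (t d)) :
    form (v d j) (X ^ (d - 1) *ᵥ v d j) ≠ 0 := by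
  rcases Nat.even_or_odd d with hd | hd
  · rcases h.form_even d j hd with h | h <;> rw [h] <;> simp
  · rw [h.form_odd d j hd]
    exact jUnit_ne_zero

theorem matrix_ext (h : IsChainBasis X t v) {A B : Matrix (Fin n) (Fin n) ℍ[ℝ]}
    (hAB : ∀ d j l, l < d → A *ᵥ (X ^ l *ᵥ v d j) = B *ᵥ (X ^ l *ᵥ v d j)) : A = B :=
  matrix_ext_of_span h.span_eq_top fun k => hAB k.1 k.2.1 k.2.2 k.2.2.2

theorem vec_ext (h : IsChainBasis X t v) {x y : Fin n → ℍ[ℝ]}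
    (hxy : ∀ d j l, l < d → form (X ^ l *ᵥ v d j) x = form (X ^ l *ᵥ v d j) y) : x = y :=
  form_ext_of_span h.span_eq_top fun k => hxy k.1 k.2.1 k.2.2 k.2.2.2

/-- The basis of `ℍⁿ` given by a basis of Jordan chains. -/
noncomputable def basis (h : IsChainBasis X t v) :
    Module.Basis ((d : ℕ) × (Fin (t d) × Fin d)) ℍ[ℝ]ᵐᵒᵖ (Fin n → ℍ[ℝ]) :=
  Module.Basis.mk h.linearIndependent h.span_eq_top.ge

theorem basis_apply (h : IsChainBasis X t v) (k : (d : ℕ) × (Fin (t d) × Fin d)) :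
    h.basis k = X ^ (k.2.2 : ℕ) *ᵥ v k.1 k.2.1 := Module.Basis.mk_apply _ _ k

theorem exists_matrix (h : IsChainBasis X t v)
    (f : (d : ℕ) → Fin (t d) → ℕ → Fin n → ℍ[ℝ]) :
    ∃ A : Matrix (Fin n) (Fin n) ℍ[ℝ], ∀ d j l, l < d → A *ᵥ (X ^ l *ᵥ v d j) = f d j l := by
  obtain ⟨A, hA⟩ := SOStar.exists_matrix
    (h.basis.constr ℕ fun k => f k.1 k.2.1 (k.2.2 : ℕ))
  refine ⟨A, fun d j l hl => ?_⟩
  have := h.basis.constr_basis ℕ (fun k => f k.1 k.2.1 (k.2.2 : ℕ)) ⟨d, j, l, hl⟩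
  rwa [basis_apply, ← hA] at this

theorem mem_lieAlg_of_chain (h : IsChainBasis X t v) {Z : Matrix (Fin n) (Fin n) ℍ[ℝ]}
    (hZ : ∀ d d' (j : Fin (t d)) (j' : Fin (t d')) (l l' : ℕ), l < d → l' < d' →
      form (Z *ᵥ (X ^ l *ᵥ v d j)) (X ^ l' *ᵥ v d' j') =
        -form (X ^ l *ᵥ v d j) (Z *ᵥ (X ^ l' *ᵥ v d' j'))) : Z ∈ lieAlg n :=
  mem_lieAlg_of_span h.span_eq_top fun k k' =>
    hZ k.1 k'.1 k.2.1 k'.2.1 k.2.2 k'.2.2 k.2.2.2 k'.2.2.2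

/-- `(H, Y)` act on the chains by the standard formulas for lowest weight vectors. -/
structure IsStandard (X H Y : Matrix (Fin n) (Fin n) ℍ[ℝ]) (t : ℕ → ℕ)
    (v : (d : ℕ) → Fin (t d) → Fin n → ℍ[ℝ]) : Prop where
  weight : ∀ d j l, l < d → H *ᵥ (X ^ l *ᵥ v d j) = (1 - d + 2 * l : ℝ) • (X ^ l *ᵥ v d j)
  lower : ∀ d j l, l < d → Y *ᵥ (X ^ l *ᵥ v d j) = (l * (d - l) : ℝ) • (X ^ (l - 1) *ᵥ v d j)

theorem exists_isStandard (h : IsChainBasis X t v) : ∃ H Y, IsStandard X H Y t v := by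
  obtain ⟨H, hH⟩ := h.exists_matrix fun d j l => (1 - d + 2 * l : ℝ) • (X ^ l *ᵥ v d j)
  obtain ⟨Y, hY⟩ := h.exists_matrix fun d j l => (l * (d - l) : ℝ) • (X ^ (l - 1) *ᵥ v d j)
  exact ⟨H, Y, hH, hY⟩

/-- Two basis vectors pair nontrivially only if `l + l' = d - 1`, and then their weights are
opposite. -/
theorem weight_mem_lieAlg (h : IsChainBasis X t v) {H Y : Matrix (Fin n) (Fin n) ℍ[ℝ]}
    (hs : IsStandard X H Y t v) : H ∈ lieAlg n := by
  refine h.mem_lieAlg_of_chain fun d d' j j' l l' hl hl' => ?_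
  rw [hs.weight d j l hl, hs.weight d' j' l' hl', form_real_smul_left, form_real_smul_right,
    ← neg_smul]
  by_cases hk : d = d' ∧ (j : ℕ) = (j' : ℕ) ∧ l + l' + 1 = d
  · obtain ⟨rfl, -, rfl⟩ := hk
    congr 1
    push_cast
    ring
  · rw [h.form_eq_zero d d' j j' l l' hl hl' hk, smul_zero, smul_zero]

theorem lower_mem_lieAlg (h : IsChainBasis X t v) {H Y : Matrix (Fin n) (Fin n) ℍ[ℝ]}
    (hs : IsStandard X H Y t v) : Y ∈ lieAlg n := by
  refine h.mem_lieAlg_of_chain fun d d' j j' l l' hl hl' => ?_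
  rw [hs.lower d j l hl, hs.lower d' j' l' hl', form_real_smul_left, form_real_smul_right]
  -- The critical case is `l + l' = d`, not `d - 1`, since `Y` lowers one exponent. Both
  -- coefficients are then `l * l'`, and the sign comes from moving one factor `X` across the form.
  by_cases hk : d = d' ∧ (j : ℕ) = (j' : ℕ) ∧ l + l' = d
  · obtain ⟨rfl, hj, hd⟩ := hk
    obtain rfl := Fin.ext hj
    obtain ⟨m, rfl⟩ : ∃ m, l = m + 1 := ⟨l - 1, by omega⟩
    obtain ⟨m', rfl⟩ : ∃ m', l' = m' + 1 := ⟨l' - 1, by omega⟩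
    subst hd
    rw [form_pow_pow h.mem_lieAlg, form_pow_pow h.mem_lieAlg, ← smul_neg, smul_smul,
      show m + 1 - 1 + (m' + 1) = m + 1 + (m' + 1 - 1) by omega, ← neg_smul, smul_smul]
    congr 1
    simp only [Nat.add_sub_cancel]
    push_cast
    ring
  · have h1 : (l * (d - l) : ℝ) • form (X ^ (l - 1) *ᵥ v d j) (X ^ l' *ᵥ v d' j') = 0 := by
      rcases l.eq_zero_or_pos with rfl | h0
      · simp
      · rw [h.form_eq_zero d d' j j' (l - 1) l' (by omega) hl' (by omega), smul_zero]
    have h2 : (l' * (d' - l') : ℝ) • form (X ^ l *ᵥ v d j) (X ^ (l' - 1) *ᵥ v d' j') = 0 := by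
      rcases l'.eq_zero_or_pos with rfl | h0
      · simp
      · rw [h.form_eq_zero d d' j j' l (l' - 1) hl (by omega) (by omega), smul_zero]
    rw [h1, h2, neg_zero]

theorem isTriple (h : IsChainBasis X t v) {H Y : Matrix (Fin n) (Fin n) ℍ[ℝ]}
    (hs : IsStandard X H Y t v) : IsTriple X H Y := by
  refine ⟨h.mem_lieAlg, h.weight_mem_lieAlg hs, h.lower_mem_lieAlg hs, ?_⟩
  have hH : ∀ d j (l : ℕ), H *ᵥ (X ^ l *ᵥ v d j) = (1 - d + 2 * l : ℝ) • (X ^ l *ᵥ v d j) :=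
    fun d j l => by
      rcases Nat.lt_or_ge l d with hl | hl
      · exact hs.weight d j l hl
      · rw [pow_mulVec_eq_zero_of_le (h.pow_eq_zero d j) hl, Matrix.mulVec_zero, smul_zero]
  -- The boundary `l = d` is needed to evaluate `⁅X, Y⁆` at the top of a chain; there both sides
  -- vanish.
  have hY : ∀ d j (l : ℕ), l ≤ d →
      Y *ᵥ (X ^ l *ᵥ v d j) = (l * (d - l) : ℝ) • (X ^ (l - 1) *ᵥ v d j) := fun d j l hl => by
    rcases hl.lt_or_eq with hl | rfl
    · exact hs.lower d j l hl
    · rw [h.pow_eq_zero l j, Matrix.mulVec_zero, sub_self, mul_zero, zero_smul]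
  have hXY : ⁅X, Y⁆ = H := h.matrix_ext fun d j l hl => by
    rw [Ring.lie_def, Matrix.sub_mulVec, ← Matrix.mulVec_mulVec, ← Matrix.mulVec_mulVec,
      mulVec_pow_mulVec, hY d j l hl.le, hY d j (l + 1) hl, hH, Matrix.mulVec_smul,
      mulVec_pow_mulVec]
    rcases l.eq_zero_or_pos with rfl | h0
    · rw [← sub_eq_zero]
      simp only [Nat.cast_zero, zero_mul, zero_smul, zero_add, Nat.sub_self, ← sub_smul, zero_sub,
        ← neg_smul]
      convert zero_smul ℝ _
      push_cast
      ring
    · rw [Nat.sub_add_cancel h0, Nat.add_sub_cancel, ← sub_smul]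
      congr 1
      push_cast
      ring
  have hHX : ⁅H, X⁆ = 2 • X := h.matrix_ext fun d j l hl => by
    rw [Ring.lie_def, Matrix.sub_mulVec, ← Matrix.mulVec_mulVec, ← Matrix.mulVec_mulVec,
      mulVec_pow_mulVec, hH, hH, Matrix.mulVec_smul, mulVec_pow_mulVec, ← sub_smul,
      ← ofNat_smul_eq_nsmul ℝ 2 X, Matrix.smul_mulVec, mulVec_pow_mulVec]
    congr 1
    push_cast
    ring
  have hHY : ⁅H, Y⁆ = -(2 • Y) := h.matrix_ext fun d j l hl => by
    rw [Ring.lie_def, Matrix.sub_mulVec, ← Matrix.mulVec_mulVec, ← Matrix.mulVec_mulVec,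
      hH, Matrix.mulVec_smul, hs.lower d j l hl, Matrix.mulVec_smul, hH, smul_smul, smul_smul,
      ← sub_smul, Matrix.neg_mulVec,
      ← ofNat_smul_eq_nsmul ℝ 2 Y, Matrix.smul_mulVec, hs.lower d j l hl, smul_smul, ← neg_smul]
    rcases l.eq_zero_or_pos with rfl | h0
    · simp
    · congr 1
      rw [Nat.cast_sub h0]
      push_cast
      ring
  -- `IsSl2Triple` demands `H ≠ 0`, so `X = 0` is separate: all chains then have length one and
  -- weight zero, hence `H = Y = 0`.
  by_cases hX0 : X = 0
  · right
    have key : ∀ d (j : Fin (t d)) l, l < d → d = 1 ∧ l = 0 := fun d j l hl => by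
      suffices d ≤ 1 by omega
      by_contra! hd
      exact h.linearIndependent.ne_zero ⟨d, j, 1, hd⟩ (by simp [hX0])
    refine ⟨hX0, h.matrix_ext fun d j l hl => ?_, h.matrix_ext fun d j l hl => ?_⟩
    · obtain ⟨rfl, rfl⟩ := key d j l hl
      rw [hs.weight 1 j 0 hl]
      simp
    · obtain ⟨rfl, rfl⟩ := key d j l hl
      rw [hs.lower 1 j 0 hl]
      simp
  · refine Or.inl ⟨fun hH0 => hX0 ?_, hXY, hHX, hHY⟩
    rw [hH0, zero_lie, ← ofNat_smul_eq_nsmul ℝ 2 X] at hHX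
    exact (smul_eq_zero.1 hHX.symm).resolve_left (by norm_num)

/-- A vector killed by `Y` is orthogonal to the image of `Y`, that is, to every chain vector below
the top of its chain. Having weight `1 - d`, it is also orthogonal to the chain tops of weight other
than `d - 1`. Only its pairings with `X ^ (d - 1) v d j` remain, and these determine the
coefficients along `v d j`. -/
theorem span_lowest (h : IsChainBasis X t v) {H Y : Matrix (Fin n) (Fin n) ℍ[ℝ]}
    (hs : IsStandard X H Y t v) {d : ℕ} (hd : 1 ≤ d) :
    Submodule.span ℍ[ℝ]ᵐᵒᵖ (Set.range (v d)) = lowestWeight H Y d := by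
  apply le_antisymm
  · rw [Submodule.span_le]
    rintro _ ⟨j, rfl⟩
    have h1 := hs.lower d j 0 hd
    have h2 := hs.weight d j 0 hd
    simp only [pow_zero, Matrix.one_mulVec, Nat.cast_zero, zero_mul, zero_smul, mul_zero,
      add_zero] at h1 h2
    exact ⟨h1, h2⟩
  · rintro x ⟨hYx, hHx⟩
    have hY' : ∀ e (j : Fin (t e)) l, l + 1 < e → form (X ^ l *ᵥ v e j) x = 0 :=
      fun e j l hl => by
        have h1 := mem_lieAlg_iff.1 (h.lower_mem_lieAlg hs) (X ^ (l + 1) *ᵥ v e j) x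
        rw [hYx, form_zero_right, neg_zero, hs.lower e j (l + 1) hl, form_real_smul_left] at h1
        refine (smul_eq_zero.1 h1).resolve_left (mul_ne_zero ?_ ?_)
        · exact Nat.cast_ne_zero.2 l.succ_ne_zero
        · rw [sub_ne_zero]
          exact_mod_cast hl.ne'
    have hH' : ∀ e (j : Fin (t e)), 0 < e → e ≠ d → form (X ^ (e - 1) *ᵥ v e j) x = 0 :=
      fun e j he hed => by
        have h1 := mem_lieAlg_iff.1 (h.weight_mem_lieAlg hs) (X ^ (e - 1) *ᵥ v e j) x
        rw [hHx, hs.weight e j (e - 1) (by omega), form_real_smul_left, form_real_smul_right,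
          ← neg_smul, ← sub_eq_zero, ← sub_smul] at h1
        refine (smul_eq_zero.1 h1).resolve_left ?_
        rw [Nat.cast_sub he]
        push_cast
        intro h2
        exact hed (by exact_mod_cast (by linarith : (e : ℝ) = d))
    have hne : ∀ j, form (X ^ (d - 1) *ᵥ v d j) (v d j) ≠ 0 := fun j h0 =>
      h.form_ne_zero d j (form_eq_zero_symm h0)
    have hx : x = ∑ j, MulOpposite.op ((form (X ^ (d - 1) *ᵥ v d j) (v d j))⁻¹ *
        form (X ^ (d - 1) *ᵥ v d j) x) • v d j := by
      refine h.vec_ext fun e j l hl => ?_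
      rw [form_sum_right]
      simp only [form_smul_right, MulOpposite.unop_op]
      by_cases hk : e = d ∧ l + 1 = e
      · obtain ⟨rfl, hle⟩ := hk
        obtain rfl : l = e - 1 := by omega
        rw [Finset.sum_eq_single j, mul_inv_cancel_left₀ (hne j)]
        · intro j' _ hj
          have := h.form_eq_zero e e j j' (e - 1) 0 hl hd (by
            rintro ⟨-, h2, -⟩
            exact hj (Fin.ext h2.symm))
          rw [pow_zero, Matrix.one_mulVec] at this
          rw [this, zero_mul]
        · simp
      · rw [Finset.sum_eq_zero]
        · rcases Nat.lt_or_ge (l + 1) e with hle | hle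
          · exact hY' e j l hle
          · obtain rfl : l = e - 1 := by omega
            exact hH' e j (by omega) fun h' => hk ⟨h', by omega⟩
        · intro j' _
          have := h.form_eq_zero e d j j' l 0 hl hd (by
            rintro ⟨h1, -, h2⟩
            exact hk ⟨h1, by omega⟩)
          rw [pow_zero, Matrix.one_mulVec] at this
          rw [this, zero_mul]
    rw [hx]
    exact Submodule.sum_mem _ fun j _ =>
      Submodule.smul_mem _ _ (Submodule.subset_span (Set.mem_range_self j))

theorem isAdaptedBasis (h : IsChainBasis X t v) {H Y : Matrix (Fin n) (Fin n) ℍ[ℝ]}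
    (hs : IsStandard X H Y t v) : IsAdaptedBasis X H Y t v where
  linearIndependent_lowest d hd := by
    have := h.linearIndependent.comp (fun j : Fin (t d) => ⟨d, j, ⟨0, hd⟩⟩) fun j j' hj => by
      simpa using hj
    convert this using 1
    funext j
    simp
  span_lowest _ hd := h.span_lowest hs hd
  pow_eq_zero := h.pow_eq_zero
  linearIndependent := h.linearIndependent
  span_eq_top := h.span_eq_top
  form_eq_zero := h.form_eq_zero
  form_even := h.form_even
  form_odd := h.form_odd

end IsChainBasis

/-! ### Existence of signed Young diagrams -/

theorem IsFrame.linearIndependent {X : Matrix (Fin n) (Fin n) ℍ[ℝ]} (hX : X ∈ lieAlg n)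
    {U : Submodule ℍ[ℝ]ᵐᵒᵖ (Fin n → ℍ[ℝ])} {ι : Type} {d : ι → ℕ} {v : ι → Fin n → ℍ[ℝ]}
    (h : IsFrame X U d v) : LinearIndependent ℍ[ℝ]ᵐᵒᵖ
      (fun b : (i : ι) × Fin (d i) => X ^ (b.2 : ℕ) *ᵥ v b.1) := by
  refine linearIndependent_of_dual (b' := fun b => X ^ (d b.1 - 1 - (b.2 : ℕ)) *ᵥ v b.1) ?_ ?_
  · rintro ⟨i, l, hl⟩
    simp only
    rw [form_pow_pow hX, Nat.sub_add_cancel (by omega)]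
    refine smul_ne_zero (pow_ne_zero _ (by norm_num)) ?_
    rcases Nat.even_or_odd (d i) with hd | hd
    · rcases h.form_even i hd with h | h <;> rw [h] <;> simp
    · rw [h.form_odd i hd]
      exact jUnit_ne_zero
  · rintro ⟨i, l, hl⟩ ⟨i', l', hl'⟩ hne
    refine h.form_eq_zero i i' _ _ ?_
    rintro ⟨rfl, h2⟩
    apply hne
    simp only at h2
    obtain rfl : l = l' := by omega
    rfl

theorem IsFrame.exists_isChainBasis {X : Matrix (Fin n) (Fin n) ℍ[ℝ]} (hX : X ∈ lieAlg n)
    {ι : Type} {d : ι → ℕ} {w : ι → Fin n → ℍ[ℝ]}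
    (h : IsFrame X ⊤ d w) {t : ℕ → ℕ} (e : ∀ k, Fin (t k) ≃ {i // d i = k}) :
    IsChainBasis X t fun k j => w (e k j).1 := by
  have hde : ∀ k j, d (e k j).1 = k := fun k j => (e k j).2
  let f : ((k : ℕ) × (Fin (t k) × Fin k)) → (i : ι) × Fin (d i) := fun b =>
    ⟨(e b.1 b.2.1).1, b.2.2.cast (hde _ _).symm⟩
  have hinj : Function.Injective f := by
    rintro ⟨k, j, l⟩ ⟨k', j', l'⟩ hff
    have h1 : (e k j).1 = (e k' j').1 := congrArg Sigma.fst hff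
    have h2 : (l : ℕ) = (l' : ℕ) := congrArg (fun b : (i : ι) × Fin (d i) => (b.2 : ℕ)) hff
    obtain rfl : k = k' := by rw [← hde k j, h1, hde]
    obtain rfl := (e k).injective (Subtype.ext h1)
    obtain rfl := Fin.ext h2
    rfl
  have hrange : Set.range (fun b : (i : ι) × Fin (d i) => X ^ (b.2 : ℕ) *ᵥ w b.1) ⊆
      Set.range fun b : (k : ℕ) × (Fin (t k) × Fin k) =>
        X ^ (b.2.2 : ℕ) *ᵥ w (e b.1 b.2.1).1 := by
    rintro _ ⟨⟨i, l⟩, rfl⟩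
    exact ⟨⟨d i, (e (d i)).symm ⟨i, rfl⟩, l⟩, by simp⟩
  refine ⟨hX, fun k j => ?_, (h.linearIndependent hX).comp f hinj, ?_, ?_, fun k j hk => ?_,
    fun k j hk => ?_⟩
  · have := h.pow_eq_zero (e k j).1
    rwa [hde] at this
  · exact top_unique (h.le_span.trans (Submodule.span_mono hrange))
  · intro k k' j j' l l' _ _ hne
    refine h.form_eq_zero _ _ l l' ?_
    rintro ⟨h1, h2⟩
    obtain rfl : k = k' := by rw [← hde k j, h1, hde]
    obtain rfl := (e k).injective (Subtype.ext h1)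
    exact hne ⟨rfl, rfl, by rw [h2, hde]⟩
  · have := h.form_even (e k j).1 (by rwa [hde])
    rwa [hde] at this
  · have := h.form_odd (e k j).1 (by rwa [hde])
    rwa [hde] at this

theorem exists_hasSignedYoungDiagram {X : Matrix (Fin n) (Fin n) ℍ[ℝ]} (hX : X ∈ lieAlg n)
    (hnil : IsNilpotent X) : ∃ D : SignedYoungDiagram n, HasSignedYoungDiagram X D := by
  classical
  obtain ⟨ι, hι, d, w, hw⟩ := exists_frame hX hnil ⊤ (fun _ _ => trivial)
    fun x _ h => form_nondegenerate fun y => h y trivial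
  have := Fintype.ofFinite ι
  have hsum : ∑ i, d i = n := by
    have h1 := Module.finrank_eq_card_basis
      (Module.Basis.mk (hw.linearIndependent hX) hw.le_span)
    rw [finrank_pi] at h1
    simpa using h1.symm
  let part : n.Partition :=
    { parts := Finset.univ.val.map d
      parts_pos := fun {i} hi => by
        obtain ⟨a, -, rfl⟩ := Multiset.mem_map.1 hi
        exact hw.pos a
      parts_sum := hsum }
  have hcount : ∀ k, part.parts.count k = Fintype.card {i // d i = k} := fun k => by
    change Multiset.count k (Finset.univ.val.map d) = _
    rw [Multiset.count_map, Fintype.card_subtype, Finset.card_def, Finset.filter_val]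
    simp only [eq_comm]
  have e : ∀ k, Fin (part.parts.count k) ≃ {i // d i = k} := fun k =>
    (finCongr (hcount k)).trans (Fintype.equivFin _).symm
  have hcb := hw.exists_isChainBasis hX e
  let p : ℕ → ℕ := fun k => if Even k then
    {j : Fin (part.parts.count k) |
      form (w (e k j).1) (X ^ (k - 1) *ᵥ w (e k j).1) = 1}.ncard else part.parts.count k
  have hp : ∀ k, p k ≤ part.parts.count k := fun k => by
    by_cases hk : Even k
    · simp only [p, if_pos hk]
      exact (Set.ncard_le_ncard (Set.subset_univ _)).trans (by simp [Set.ncard_univ])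
    · simp [p, if_neg hk]
  obtain ⟨H, Y, hs⟩ := hcb.exists_isStandard
  refine ⟨⟨part, p, fun k => part.parts.count k - p k, fun k => Nat.add_sub_cancel' (hp k)⟩,
    H, Y, fun k j => w (e k j).1, hcb.isTriple hs, hcb.isAdaptedBasis hs, fun k hk => ?_,
    fun k hk => ?_⟩
  · simp only [p, if_pos hk]
  · simp only [p, if_neg (Nat.not_even_iff_odd.2 hk)]

/-! ### Real elements have balanced signs -/

theorem pow_mulVec_of_anticomm {X g : Matrix (Fin n) (Fin n) ℍ[ℝ]} (h : g * X = -(X * g))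
    (k : ℕ) (x : Fin n → ℍ[ℝ]) : X ^ k *ᵥ (g *ᵥ x) = (-1 : ℝ) ^ k • (g *ᵥ (X ^ k *ᵥ x)) := by
  induction k with
  | zero => simp
  | succ k ih =>
    have h1 : ∀ y, X *ᵥ (g *ᵥ y) = -(g *ᵥ (X *ᵥ y)) := fun y => by
      rw [Matrix.mulVec_mulVec, Matrix.mulVec_mulVec, h, Matrix.neg_mulVec, neg_neg]
    rw [← mulVec_pow_mulVec, ih, Matrix.mulVec_smul, h1, mulVec_pow_mulVec, pow_succ (-1 : ℝ),
      mul_neg_one, neg_smul, smul_neg]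

theorem mul_eq_neg_of_conj {X : Matrix (Fin n) (Fin n) ℍ[ℝ]}
    {g : (Matrix (Fin n) (Fin n) ℍ[ℝ])ˣ} (h : g.val * X * (g⁻¹).val = -X) :
    g.val * X = -(X * g.val) := by
  rw [← neg_mul, ← h, mul_assoc, Units.inv_mul, mul_one]

namespace IsChainBasis

variable {X : Matrix (Fin n) (Fin n) ℍ[ℝ]} {t : ℕ → ℕ}
  {v : (d : ℕ) → Fin (t d) → Fin n → ℍ[ℝ]}

theorem finite_index (h : IsChainBasis X t v) :
    Finite ((d : ℕ) × (Fin (t d) × Fin d)) := Module.Finite.finite_basis h.basis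

/-- Coordinates can be read off from the form, because the Gram matrix of each chain is antidiagonal
and distinct chains are orthogonal. -/
theorem form_dual (h : IsChainBasis X t v) {e : ℕ} (j : Fin (t e)) (l : Fin e)
    (y : Fin n → ℍ[ℝ]) : form (X ^ (e - 1 - (l : ℕ)) *ᵥ v e j) y =
      (-1 : ℝ) ^ (e - 1 - (l : ℕ)) • form (v e j) (X ^ (e - 1) *ᵥ v e j) *
        (h.basis.repr y ⟨e, j, l⟩).unop := by
  have := h.finite_index
  have := Fintype.ofFinite ((d : ℕ) × (Fin (t d) × Fin d))
  have hl := l.2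
  conv_lhs => rw [← h.basis.sum_repr y]
  rw [form_sum_right, Finset.sum_eq_single ⟨e, j, l⟩]
  · rw [form_smul_right, basis_apply, form_pow_pow h.mem_lieAlg]
    simp only
    rw [Nat.sub_add_cancel (by omega)]
  · rintro ⟨e', j', l'⟩ _ hne
    rw [form_smul_right, basis_apply, h.form_eq_zero e e' j j' _ _ (by omega) l'.2, zero_mul]
    rintro ⟨rfl, h1, h2⟩
    obtain rfl := Fin.ext h1
    obtain rfl : l' = l := Fin.ext (by omega)
    exact hne rfl
  · simp

/-- The vector dual to position `l` is `X ^ (e - 1 - l) v`; for `l + d < e` it lies in the image of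
`X ^ d`, which is orthogonal to the kernel of `X ^ d`. -/
theorem repr_eq_zero (h : IsChainBasis X t v) {d : ℕ} {y : Fin n → ℍ[ℝ]} (hy : X ^ d *ᵥ y = 0)
    {e : ℕ} (j : Fin (t e)) (l : Fin e) (hl : l + d < e) : h.basis.repr y ⟨e, j, l⟩ = 0 := by
  have h1 : form (X ^ (e - 1 - (l : ℕ)) *ᵥ v e j) y = 0 := by
    rw [show e - 1 - (l : ℕ) = d + (e - 1 - l - d) by omega, ← pow_mulVec_pow_mulVec,
      form_pow_left h.mem_lieAlg, hy, form_zero_right, smul_zero]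
  rw [h.form_dual] at h1
  exact MulOpposite.unop_injective ((mul_eq_zero.1 h1).resolve_left
    (smul_ne_zero (pow_ne_zero _ (by norm_num)) (h.form_ne_zero e j)))

/-- The form `⟨y, X ^ (d - 1) y⟩` on `ker X ^ d` is semidefinite where the coordinates of one sign
vanish. -/
theorem form_pow_nonneg (h : IsChainBasis X t v) {d : ℕ} (hd : 0 < d) (hde : Even d) {s : ℝ}
    (hs : s = 1 ∨ s = -1) {y : Fin n → ℍ[ℝ]} (hy : X ^ d *ᵥ y = 0)
    (hc : ∀ j : Fin (t d), form (v d j) (X ^ (d - 1) *ᵥ v d j) = ((-s : ℝ) : ℍ[ℝ]) →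
      h.basis.repr y ⟨d, j, ⟨0, hd⟩⟩ = 0) :
    0 ≤ s * (form y (X ^ (d - 1) *ᵥ y)).re := by
  have := h.finite_index
  have := Fintype.ofFinite ((d : ℕ) × (Fin (t d) × Fin d))
  have hexp : form y (X ^ (d - 1) *ᵥ y) = ∑ k', ∑ k, star (h.basis.repr y k).unop *
      form (h.basis k) (X ^ (d - 1) *ᵥ h.basis k') * (h.basis.repr y k').unop := by
    conv_lhs => rw [← h.basis.sum_repr y]
    rw [← mulVecHom_apply, map_sum, form_sum_right]
    refine Finset.sum_congr rfl fun k' _ => ?_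
    rw [form_sum_left]
    refine Finset.sum_congr rfl fun k _ => ?_
    rw [map_smul, form_smul_right, form_smul_left, mulVecHom_apply]
  have hre : ∀ (f : ((d : ℕ) × (Fin (t d) × Fin d)) → ℍ[ℝ]), (∑ k, f k).re = ∑ k, (f k).re :=
    fun f => map_sum (⟨⟨fun q : ℍ[ℝ] => q.re, rfl⟩, fun _ _ => rfl⟩ : ℍ[ℝ] →+ ℝ) f _
  rw [hexp, hre, Finset.mul_sum]
  refine Finset.sum_nonneg fun k' _ => ?_
  rw [hre, Finset.mul_sum]
  refine Finset.sum_nonneg fun k _ => ?_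
  obtain ⟨e, j, l⟩ := k
  obtain ⟨e', j', l'⟩ := k'
  rcases Nat.lt_or_ge (l + d) e with hle | hle
  · rw [h.repr_eq_zero hy j l hle]
    simp
  rcases Nat.lt_or_ge (l' + d) e' with hle' | hle'
  · rw [h.repr_eq_zero hy j' l' hle']
    simp
  rw [basis_apply, basis_apply, pow_mulVec_pow_mulVec]
  simp only
  have hzero : ∀ z : ℍ[ℝ], z = 0 →
      0 ≤ s * (star (h.basis.repr y ⟨e, j, l⟩).unop * z *
        (h.basis.repr y ⟨e', j', l'⟩).unop).re := by
    rintro _ rfl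
    simp
  rcases Nat.lt_or_ge (d - 1 + l') e' with hlt | hge
  swap
  · exact hzero _ (by rw [pow_mulVec_eq_zero_of_le (h.pow_eq_zero e' j') hge, form_zero_right])
  by_cases hk : e = e' ∧ (j : ℕ) = (j' : ℕ) ∧ l + (d - 1 + l') + 1 = e
  swap
  · exact hzero _ (h.form_eq_zero e e' j j' l _ l.2 hlt hk)
  obtain ⟨rfl, hj, hll⟩ := hk
  obtain rfl := Fin.ext hj
  -- The bounds `e ≤ l + d` and `e ≤ l' + d` together with `l + l' + d = e` force `l = l' = 0`: only
  -- the bottoms of the chains of length `d` contribute.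
  obtain rfl : d = e := by omega
  obtain rfl : l = ⟨0, hd⟩ := Fin.ext (by simp only; omega)
  obtain rfl : l' = ⟨0, hd⟩ := Fin.ext (by simp only; omega)
  by_cases hj : form (v d j) (X ^ (d - 1) *ᵥ v d j) = ((-s : ℝ) : ℍ[ℝ])
  · rw [hc j hj]
    simp
  have hj' : form (v d j) (X ^ (d - 1) *ᵥ v d j) = (s : ℍ[ℝ]) := by
    rcases hs with rfl | rfl <;> rcases h.form_even d j hde with h1 | h1 <;>
      first
      | (rw [h1]; simp; done)
      | exact absurd (by rw [h1]; simp) hj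
  simp only [add_zero, pow_zero, Matrix.one_mulVec]
  rw [hj', ← Quaternion.coe_commutes, mul_assoc, Quaternion.star_mul_self, ← Quaternion.coe_mul,
    Quaternion.re_coe, ← mul_assoc]
  exact mul_nonneg (mul_self_nonneg s) Quaternion.normSq_nonneg

/-- Sylvester's argument. Apply `g` to the span of the `v d j` of sign `s` and record the
coordinates of sign `-s`. A vector with zero record has image on which the form is semidefinite of
sign `s`; but `g` negates the form, which was definite of sign `s`, so the vector is zero. The
injection bounds the dimensions. -/
theorem card_le_card_neg (h : IsChainBasis X t v) {g : (Matrix (Fin n) (Fin n) ℍ[ℝ])ˣ}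
    (hg : g ∈ group n) (hgX : g.val * X = -(X * g.val)) {d : ℕ} (hd : 0 < d) (hde : Even d)
    {s : ℝ} (hs : s = 1 ∨ s = -1) :
    Nat.card {j // form (v d j) (X ^ (d - 1) *ᵥ v d j) = (s : ℍ[ℝ])} ≤
      Nat.card {j // form (v d j) (X ^ (d - 1) *ᵥ v d j) = ((-s : ℝ) : ℍ[ℝ])} := by
  classical
  have hss : s * s = 1 := by rcases hs with rfl | rfl <;> norm_num
  let W : ({j // form (v d j) (X ^ (d - 1) *ᵥ v d j) = (s : ℍ[ℝ])} → ℍ[ℝ]ᵐᵒᵖ) →ₗ[ℍ[ℝ]ᵐᵒᵖ]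
      (Fin n → ℍ[ℝ]) := Fintype.linearCombination ℍ[ℝ]ᵐᵒᵖ fun j => v d j.1
  have hW : ∀ a, W a = ∑ j, a j • v d j.1 := fun a => Fintype.linearCombination_apply _ _ _
  let F : ({j // form (v d j) (X ^ (d - 1) *ᵥ v d j) = (s : ℍ[ℝ])} → ℍ[ℝ]ᵐᵒᵖ) →ₗ[ℍ[ℝ]ᵐᵒᵖ]
      ({j // form (v d j) (X ^ (d - 1) *ᵥ v d j) = ((-s : ℝ) : ℍ[ℝ])} → ℍ[ℝ]ᵐᵒᵖ) :=
    LinearMap.pi fun k => h.basis.coord ⟨d, k.1, ⟨0, hd⟩⟩ ∘ₗ mulVecHom g.val ∘ₗ W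
  have hF : Function.Injective F := by
    rw [injective_iff_map_eq_zero]
    intro a ha
    have hker : X ^ d *ᵥ W a = 0 := by
      rw [hW, ← mulVecHom_apply, map_sum]
      refine Finset.sum_eq_zero fun j _ => ?_
      rw [map_smul, mulVecHom_apply, h.pow_eq_zero, smul_zero]
    have hnn := h.form_pow_nonneg hd hde hs (y := g.val *ᵥ W a)
      (by rw [pow_mulVec_of_anticomm hgX, hker, Matrix.mulVec_zero, smul_zero])
      (fun j hj => congrFun ha ⟨j, hj⟩)
    have hodd : Odd (d - 1) := by
      exact Nat.Even.sub_odd hd hde odd_one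
    rw [pow_mulVec_of_anticomm hgX, hodd.neg_one_pow, form_real_smul_right, form_group hg] at hnn
    have hval : form (W a) (X ^ (d - 1) *ᵥ W a) =
        ((s * ∑ j, Quaternion.normSq (a j).unop : ℝ) : ℍ[ℝ]) := by
      rw [hW, ← mulVecHom_apply, map_sum, form_sum_right, Finset.mul_sum]
      refine Eq.trans ?_ (map_sum (algebraMap ℝ ℍ[ℝ])
        (fun j => s * Quaternion.normSq (a j).unop) Finset.univ).symm
      refine Finset.sum_congr rfl fun j _ => ?_
      rw [form_sum_left, Finset.sum_eq_single j, map_smul, form_smul_right, form_smul_left,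
        mulVecHom_apply, j.2, ← Quaternion.coe_commutes, mul_assoc, Quaternion.star_mul_self]
      · exact (Quaternion.coe_mul _ _).symm
      · intro j' _ hj
        have h0 := h.form_eq_zero d d j'.1 j.1 0 (d - 1) hd (by omega)
          fun h' => hj (Subtype.ext (Fin.ext h'.2.1))
        rw [pow_zero, Matrix.one_mulVec] at h0
        rw [map_smul, form_smul_right, form_smul_left, mulVecHom_apply, h0]
        simp
      · simp
    rw [hval, neg_one_smul, Quaternion.re_neg, Quaternion.re_coe, mul_neg, ← mul_assoc, hss,
      one_mul, neg_nonneg] at hnn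
    have h0 := (Finset.sum_eq_zero_iff_of_nonneg fun j _ => Quaternion.normSq_nonneg).1
      (le_antisymm hnn (Finset.sum_nonneg fun j _ => Quaternion.normSq_nonneg))
    funext j
    exact MulOpposite.unop_injective (Quaternion.normSq_eq_zero.1 (h0 j (Finset.mem_univ j)))
  simpa [Nat.card_eq_fintype_card] using LinearMap.finrank_le_finrank_of_injective hF

end IsChainBasis

/-! ### Constructing involutions -/

theorem nrd_mul (A B : Matrix (Fin n) (Fin n) ℍ[ℝ]) : nrd (A * B) = nrd A * nrd B := by
  rw [nrd, toComplex_mul, Matrix.det_mul, nrd, nrd]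

theorem nrd_one : nrd (1 : Matrix (Fin n) (Fin n) ℍ[ℝ]) = 1 := by
  rw [nrd, toComplex_one, Matrix.det_one]

/-- A real matrix has no `j` part, so its complex image is block diagonal with two copies of `M`. -/
theorem nrd_map_coe (M : Matrix (Fin n) (Fin n) ℝ) :
    nrd (M.map fun r : ℝ => (r : ℍ[ℝ])) = ((M.det ^ 2 : ℝ) : ℂ) := by
  have h : toComplex (M.map fun r : ℝ => (r : ℍ[ℝ])) =
      Matrix.fromBlocks (M.map Complex.ofRealHom) 0 0 (M.map Complex.ofRealHom) := by
    rw [toComplex]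
    congr 1 <;> ext i k <;> simp [zPart, wPart, Complex.ext_iff]
  have hdet : (M.map Complex.ofRealHom).det = (M.det : ℂ) := (RingHom.map_det _ M).symm
  rw [nrd, h, Matrix.det_fromBlocks_zero₂₁, hdet]
  push_cast
  ring

/-- An involution which is real in some basis has reduced norm one. -/
theorem nrd_eq_one_of_real {κ : Type*} [Finite κ]
    (b : Module.Basis κ ℍ[ℝ]ᵐᵒᵖ (Fin n → ℍ[ℝ])) {T : Matrix (Fin n) (Fin n) ℍ[ℝ]}
    (hT : T * T = 1) (σ : κ → κ) (ε : κ → ℝ) (h : ∀ k, T *ᵥ b k = ε k • b (σ k)) :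
    nrd T = 1 := by
  classical
  have := Fintype.ofFinite κ
  have hcard : Fintype.card κ = n := by
    rw [← Module.finrank_eq_card_basis b, finrank_pi]
  let e : κ ≃ Fin n := Fintype.equivFinOfCardEq hcard
  -- `P` has the basis as columns, `P'` inverts it, and `M` is the real matrix of `T` in that basis,
  -- so `nrd T = det M ^ 2`.
  let P : Matrix (Fin n) (Fin n) ℍ[ℝ] := Matrix.of fun i k => b (e.symm k) i
  let P' : Matrix (Fin n) (Fin n) ℍ[ℝ] :=
    Matrix.of fun k i => (b.repr (Pi.single i 1) (e.symm k)).unop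
  let M : Matrix (Fin n) (Fin n) ℝ :=
    Matrix.of fun k' k => if k' = e (σ (e.symm k)) then ε (e.symm k) else 0
  have hPP' : P * P' = 1 := by
    ext1 i k
    have h1 := congrFun (b.sum_repr (Pi.single k 1)) i
    rw [Finset.sum_apply, ← e.symm.sum_comp] at h1
    simpa [Matrix.mul_apply, P, P', MulOpposite.smul_eq_mul_unop, Matrix.one_apply,
      Pi.single_apply] using h1
  have hTP : T * P = P * M.map fun r : ℝ => (r : ℍ[ℝ]) := by
    ext1 i k
    have h1 := congrFun (h (e.symm k)) i
    rw [Matrix.mul_apply (M := P), Finset.sum_eq_single (e (σ (e.symm k)))]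
    · simpa [P, M, Matrix.mul_apply, Matrix.mulVec, dotProduct, Quaternion.mul_coe_eq_smul] using h1
    · intro k' _ hk'
      simp [M, hk']
    · simp
  have hTM : nrd T = ((M.det ^ 2 : ℝ) : ℂ) := by
    have h1 : nrd P * nrd P' = 1 := by rw [← nrd_mul, hPP', nrd_one]
    calc nrd T = nrd (T * P * P') := by rw [mul_assoc, hPP', mul_one]
      _ = nrd P * nrd P' * ((M.det ^ 2 : ℝ) : ℂ) := by
        rw [hTP, nrd_mul, nrd_mul, nrd_map_coe]
        ring
      _ = _ := by rw [h1, one_mul]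
  have hsq : nrd T * nrd T = 1 := by rw [← nrd_mul, hT, nrd_one]
  rw [hTM] at hsq ⊢
  have h2 : (M.det ^ 2) * (M.det ^ 2) = 1 := by exact_mod_cast hsq
  -- Nonnegativity of the square rules out the value `-1`.
  have h3 : M.det ^ 2 = 1 := by nlinarith [sq_nonneg M.det]
  rw [h3, Complex.ofReal_one]

/-- The involution sends `X ^ l v_j` to `(-1) ^ l X ^ l v_{s j}`. The alternating signs give
anticommutation with `X`; they multiply a nonzero pairing by `(-1) ^ (l + l') = (-1) ^ (d - 1)`,
which `hform` compensates. -/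
theorem IsChainBasis.isStronglyAdReal {X : Matrix (Fin n) (Fin n) ℍ[ℝ]} {t : ℕ → ℕ}
    {v : (d : ℕ) → Fin (t d) → Fin n → ℍ[ℝ]} (h : IsChainBasis X t v)
    (s : (d : ℕ) → Fin (t d) → Fin (t d)) (hs : ∀ d, Function.Involutive (s d))
    (hform : ∀ d j, 0 < d → form (v d (s d j)) (X ^ (d - 1) *ᵥ v d (s d j)) =
      (-1 : ℝ) ^ (d - 1) • form (v d j) (X ^ (d - 1) *ᵥ v d j)) : IsStronglyAdReal X := by
  obtain ⟨T, hT⟩ := h.exists_matrix fun d j l => (-1 : ℝ) ^ l • (X ^ l *ᵥ v d (s d j))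
  have hTT : T * T = 1 := h.matrix_ext fun d j l hl => by
    rw [← Matrix.mulVec_mulVec, hT d j l hl, Matrix.mulVec_smul, hT d _ l hl, hs d j, smul_smul,
      ← mul_pow, Matrix.one_mulVec]
    simp
  have hTX : T * X = -X * T := h.matrix_ext fun d j l hl => by
    rw [← Matrix.mulVec_mulVec, ← Matrix.mulVec_mulVec, mulVec_pow_mulVec, hT d j l hl,
      Matrix.mulVec_smul, Matrix.neg_mulVec, mulVec_pow_mulVec]
    rcases Nat.lt_or_ge (l + 1) d with hl' | hl'
    · rw [hT d j (l + 1) hl', pow_succ, mul_neg_one, neg_smul, smul_neg]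
    · rw [pow_mulVec_eq_zero_of_le (h.pow_eq_zero d j) hl',
        pow_mulVec_eq_zero_of_le (h.pow_eq_zero d (s d j)) hl']
      simp
  have hfin : Finite ((d : ℕ) × (Fin (t d) × Fin d)) := Module.Finite.finite_basis h.basis
  have hnrd : nrd T = 1 := nrd_eq_one_of_real h.basis hTT
    (fun k => ⟨k.1, s k.1 k.2.1, k.2.2⟩) (fun k => (-1 : ℝ) ^ (k.2.2 : ℕ)) fun k => by
      rw [h.basis_apply, h.basis_apply, hT _ _ _ k.2.2.2]
  let τ : (Matrix (Fin n) (Fin n) ℍ[ℝ])ˣ := ⟨T, T, hTT, hTT⟩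
  refine ⟨τ, mem_group_of_span h.span_eq_top hnrd ?_, Units.ext (by rw [sq]; exact hTT), ?_⟩
  · rintro ⟨d, j, l, hl⟩ ⟨d', j', l', hl'⟩
    change form (T *ᵥ (X ^ l *ᵥ v d j)) (T *ᵥ (X ^ l' *ᵥ v d' j')) =
      form (X ^ l *ᵥ v d j) (X ^ l' *ᵥ v d' j')
    rw [hT d j l hl, hT d' j' l' hl', form_real_smul_left, form_real_smul_right]
    by_cases hk : d = d' ∧ (j : ℕ) = (j' : ℕ) ∧ l + l' + 1 = d
    · obtain ⟨rfl, hj, hd⟩ := hk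
      obtain rfl := Fin.ext hj
      have hll : l + l' = d - 1 := by omega
      rw [form_pow_pow h.mem_lieAlg, form_pow_pow h.mem_lieAlg, hll, hform d j (by omega), ← hll,
        pow_add]
      simp only [smul_smul]
      congr 1
      rcases neg_one_pow_eq_or ℝ l with h1 | h1 <;> rcases neg_one_pow_eq_or ℝ l' with h2 | h2 <;>
        rw [h1, h2] <;> norm_num
    · rw [h.form_eq_zero d d' j j' l l' hl hl' hk, h.form_eq_zero d d' _ _ l l' hl hl', smul_zero,
        smul_zero]
      rintro ⟨rfl, h1, h2⟩
      exact hk ⟨rfl, congrArg Fin.val ((hs d).injective (Fin.ext h1)), h2⟩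
  · change T * X * T = -X
    rw [hTX, mul_assoc, hTT, mul_one]

theorem exists_involutive_swap {α : Type*} [Finite α] {p q : α → Prop}
    (hpq : ∀ a, ¬p a ↔ q a) (hcard : Nat.card {a // p a} = Nat.card {a // q a}) :
    ∃ s : α → α, Function.Involutive s ∧ ∀ a, p (s a) ↔ ¬p a := by
  classical
  obtain ⟨e⟩ := (Finite.card_eq).1 hcard
  refine ⟨fun a => if h : p a then (e ⟨a, h⟩).1 else (e.symm ⟨a, (hpq a).1 h⟩).1, fun a => ?_,
    fun a => ?_⟩
  · by_cases h : p a
    · have h1 : ¬p (e ⟨a, h⟩).1 := (hpq _).2 (e ⟨a, h⟩).2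
      simp [h, h1]
    · have h1 : p (e.symm ⟨a, (hpq a).1 h⟩).1 := (e.symm ⟨a, (hpq a).1 h⟩).2
      simp [h, h1]
  · by_cases h : p a
    · have h1 : ¬p (e ⟨a, h⟩).1 := (hpq _).2 (e ⟨a, h⟩).2
      simp [h, h1]
    · have h1 : p (e.symm ⟨a, (hpq a).1 h⟩).1 := (e.symm ⟨a, (hpq a).1 h⟩).2
      simp [h, h1]

/-! ### Signs and the diagram -/

theorem nat_card_add_nat_card_not {α : Type*} [Finite α] (p : α → Prop) :
    Nat.card {a // p a} + Nat.card {a // ¬p a} = Nat.card α := by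
  classical
  rw [← Nat.card_sum, Nat.card_congr (Equiv.sumCompl p)]

namespace IsChainBasis

variable {X : Matrix (Fin n) (Fin n) ℍ[ℝ]} {t : ℕ → ℕ}
  {v : (d : ℕ) → Fin (t d) → Fin n → ℍ[ℝ]}

theorem form_ne_one_iff (h : IsChainBasis X t v) {d : ℕ} (hd : Even d) (j : Fin (t d)) :
    ¬form (v d j) (X ^ (d - 1) *ᵥ v d j) = 1 ↔ form (v d j) (X ^ (d - 1) *ᵥ v d j) = -1 := by
  have h11 : (1 : ℍ[ℝ]) ≠ -1 := fun h => by
    have := congrArg QuaternionAlgebra.re h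
    norm_num at this
  rcases h.form_even d j hd with h1 | h1 <;> rw [h1]
  · simp [h11]
  · simp [h11.symm]

theorem card_add_card (h : IsChainBasis X t v) {d : ℕ} (hd : Even d) :
    Nat.card {j // form (v d j) (X ^ (d - 1) *ᵥ v d j) = 1} +
      Nat.card {j // form (v d j) (X ^ (d - 1) *ᵥ v d j) = -1} = t d := by
  rw [← Nat.card_congr (Equiv.subtypeEquivRight (h.form_ne_one_iff hd)),
    nat_card_add_nat_card_not, Nat.card_eq_fintype_card, Fintype.card_fin]

theorem card_eq_card_of_isAdReal (h : IsChainBasis X t v) (hX : IsAdReal X) {d : ℕ} (hd : 0 < d)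
    (hde : Even d) : Nat.card {j // form (v d j) (X ^ (d - 1) *ᵥ v d j) = 1} =
      Nat.card {j // form (v d j) (X ^ (d - 1) *ᵥ v d j) = -1} := by
  obtain ⟨g, hg, hgX⟩ := hX
  have hgX' := mul_eq_neg_of_conj hgX
  apply le_antisymm
  · simpa using h.card_le_card_neg hg hgX' hd hde (Or.inl rfl)
  · simpa using h.card_le_card_neg hg hgX' hd hde (Or.inr rfl)

theorem isStronglyAdReal_of_card_eq_card (h : IsChainBasis X t v)
    (hcard : ∀ d, 0 < d → Even d →
      Nat.card {j // form (v d j) (X ^ (d - 1) *ᵥ v d j) = 1} =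
        Nat.card {j // form (v d j) (X ^ (d - 1) *ᵥ v d j) = -1}) : IsStronglyAdReal X := by
  have hex : ∀ d, ∃ s : Fin (t d) → Fin (t d), Function.Involutive s ∧
      ∀ j, 0 < d → form (v d (s j)) (X ^ (d - 1) *ᵥ v d (s j)) =
        (-1 : ℝ) ^ (d - 1) • form (v d j) (X ^ (d - 1) *ᵥ v d j) := fun d => by
    rcases d.eq_zero_or_pos with rfl | hd
    -- Length zero contributes no basis vectors, so any involution serves.
    · exact ⟨id, fun _ => rfl, fun j hj => absurd hj (lt_irrefl 0)⟩
    rcases Nat.even_or_odd d with hde | hdo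
    · obtain ⟨s, hs, hs'⟩ := exists_involutive_swap (h.form_ne_one_iff hde) (hcard d hd hde)
      refine ⟨s, hs, fun j _ => ?_⟩
      rw [(Nat.Even.sub_odd hd hde odd_one).neg_one_pow, neg_one_smul]
      by_cases hj : form (v d j) (X ^ (d - 1) *ᵥ v d j) = 1
      · rw [hj, (h.form_ne_one_iff hde _).1 fun h' => (hs' j).1 h' hj]
      · rw [(hs' j).2 hj, (h.form_ne_one_iff hde j).1 hj, neg_neg]
    -- For odd `d` the required sign `(-1) ^ (d - 1)` is `1`, so no rows need to be exchanged.
    · refine ⟨id, fun _ => rfl, fun j _ => ?_⟩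
      rw [(Nat.Odd.sub_odd hdo odd_one).neg_one_pow, one_smul, id]
  choose s hs hs' using hex
  exact h.isStronglyAdReal s hs hs'

end IsChainBasis

end SOStar

theorem mainTheorem7 (n : ℕ) (X : Matrix (Fin n) (Fin n) (Quaternion ℝ))
    (hX : X ∈ SOStar.lieAlg n) (hnil : IsNilpotent X) :
    (∃ D : SOStar.SignedYoungDiagram n, SOStar.HasSignedYoungDiagram X D) ∧
    ∀ D : SOStar.SignedYoungDiagram n, SOStar.HasSignedYoungDiagram X D →
      List.TFAE [
        SOStar.IsAdReal X,
        SOStar.IsStronglyAdReal X,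
        ∀ η ∈ D.partition.parts, Even η → D.p η = D.q η] := by
  refine ⟨SOStar.exists_hasSignedYoungDiagram hX hnil, ?_⟩
  rintro D ⟨H, Y, v, -, hab, hp, -⟩
  have hcb := hab.isChainBasis hX
  have hq : ∀ d, Even d → D.q d =
      Nat.card {j // SOStar.form (v d j) (X ^ (d - 1) *ᵥ v d j) = -1} := fun d hd => by
    have h1 := D.p_add_q d
    have h2 := hcb.card_add_card hd
    rw [hp d hd, ← Nat.card_coe_set_eq] at h1
    exact Nat.add_left_cancel (h1.trans h2.symm)
  tfae_have 1 → 3 := fun h η hη hde => by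
    rw [hp η hde, hq η hde, ← Nat.card_coe_set_eq]
    exact hcb.card_eq_card_of_isAdReal h (D.partition.parts_pos hη) hde
  tfae_have 3 → 2 := fun h => by
    refine hcb.isStronglyAdReal_of_card_eq_card fun d _ hde => ?_
    by_cases hd : d ∈ D.partition.parts
    · have h1 := h d hd hde
      rw [hp d hde, hq d hde, ← Nat.card_coe_set_eq] at h1
      exact h1
    -- If `d` is not a part there are no rows of length `d`, and both counts are zero.
    · have h1 := (hcb.card_add_card hde).trans (Multiset.count_eq_zero_of_notMem hd)
      omega
  tfae_have 2 → 1 := fun ⟨τ, hτ, _, h⟩ => ⟨τ, hτ, h⟩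
  tfae_finish
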